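/- Let $T>0$ and $D:=\mathbb R^4\times[0,T]$. Let $(u_k)_{k\in\mathbb N}$ be a bounded sequence of $\mathbb R^4$-valued functions in $L^\infty_tL^2_x\cap L^2_tH^1_x(D)$, let $u\in L^\infty_tL^2_x\cap L^2_tH^1_x(D)$, and suppose that $u_k\to u$ in $L^1_{\mathrm{loc}}(D)$. Write $|\nabla u|^2=\sum_{j}|\partial_{x_j}u|^2$ for the weak spatial gradient. Suppose that $\mu_k:=|\nabla u_k|^2\,dx\,dt\to\mu$ and $\nu_k:=|u_k|^3\,dx\,dt\to\nu$ weakly as measures on $D$ (tested against continuous functions with compact support in $D$), where $\mu,\nu$ are finite nonnegative measures on $D$. Then $|u|^3$ is integrable on $D$, and there are finite nonnegative measures $\lambda,\omega$ on $D$ such that for every $\varphi\in C_c^\infty(D)$ (that is, $\varphi$ is the restriction to $D$ of a function in $C_c^\infty(\mathbb R^4\times\mathbb R)$) $$\iint\varphi\,d\mu=\iint_D\varphi\,|\nabla u|^2\,dx\,dt+\iint\varphi\,d\lambda,\qquad \iint\varphi\,d\nu=\iint_D\varphi\,|u|^3\,dx\,dt+\iint\varphi\,d\omega .$$ Moreover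 $\omega\ll\lambda$, and there is an absolute constant $C$ (independent of $T$, of the functions and of the measures) such that for every relatively open set $Q\subset D$ $$\omega(Q)\le C\,\Big(\liminf_{k\to\infty}\|u_k-u\|_{L^\infty_tL^2_x(Q)}\Big)\,\lambda(Q),$$ where $\|v\|_{L^\infty_tL^2_x(Q)}:=\operatorname{ess\,sup}_{t}\big(\int_{\{x:(x,t)\in Q\}}|v(x,t)|^2\,dx\big)^{1/2}$. In particular, with the same $C$, for $\lambda$-almost every $(x_0,t_0)\in D$ the limit below exists and the Radon–Nikodym derivative satisfies $$\frac{d\omega}{d\lambda}(x_0,t_0)\le C\lim_{r\to0^+}\liminf_{k\to\infty}\|u_k-u\|_{L^\infty_tL^2_x(Q_r^*(x_0,t_0)\cap D)},$$ where $Q_r^*(x_0,t_0):=\{x:|x-x_0|<r\}\times(t_0-\tfrac{r^2}{2},t_0+\tfrac{r^2}{2})$. -/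

import Mathlib

open MeasureTheory Filter Topology Set
open scoped NNReal ENNReal

noncomputable section

namespace ParabolicCC

/-- The space `ℝ⁴` with its Euclidean norm. -/
abbrev R4 : Type := EuclideanSpace ℝ (Fin 4)

/-- Space-time `ℝ⁴ × ℝ`; points are written `(x, t)`. Its volume is Lebesgue measure `dx dt`. -/
abbrev SpaceTime : Type := R4 × ℝ

/-- The slab `D = ℝ⁴ × [0, T]`. -/
def slab (T : ℝ) : Set SpaceTime := univ ×ˢ Icc 0 T

/-- `g` is the weak partial derivative `∂ⱼ f` on `ℝ⁴` of the `ℝ⁴`-valued function `f`. -/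
def IsWeakPartial (j : Fin 4) (f g : R4 → R4) : Prop :=
  LocallyIntegrable f volume ∧ LocallyIntegrable g volume ∧
    ∀ ψ : R4 → ℝ, ContDiff ℝ ((⊤ : ℕ∞) : WithTop ℕ∞) ψ → HasCompactSupport ψ →
      ∫ x, (fderiv ℝ ψ x (EuclideanSpace.single j 1)) • f x = - ∫ x, ψ x • g x

/-- The squared Euclidean (Frobenius) length `|∇u|² = ∑ⱼ |∂ⱼu|²`, where `Du j` is `∂ⱼu`. -/
def gradSq (Du : Fin 4 → SpaceTime → R4) (z : SpaceTime) : ℝ := ∑ j, ‖Du j z‖ ^ 2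

/-- The norm `‖v‖_{L^∞_t L²_x(Q)}`: the essential supremum over `t` of the `L²` norm of
`v(·, t)` on the time slice `{x | (x, t) ∈ Q}`. -/
def normLinfL2 (Q : Set SpaceTime) (v : SpaceTime → R4) : ℝ≥0∞ :=
  essSup (fun t : ℝ => eLpNorm (fun x : R4 => v (x, t)) 2 (volume.restrict {x : R4 | (x, t) ∈ Q}))
    volume

/-- The norm of `u` in `L²_t H¹_x(D)`, where `Du` is the spatial gradient of `u`. -/
def normL2H1 (T : ℝ) (u : SpaceTime → R4) (Du : Fin 4 → SpaceTime → R4) : ℝ≥0∞ :=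
  (∫⁻ z in slab T, ENNReal.ofReal (‖u z‖ ^ 2 + gradSq Du z)) ^ (1 / 2 : ℝ)

/-- `u ∈ L^∞_t L²_x ∩ L²_t H¹_x(D)` with weak spatial derivatives `Du j = ∂ⱼu`. -/
structure IsEnergyClass (T : ℝ) (u : SpaceTime → R4) (Du : Fin 4 → SpaceTime → R4) : Prop where
  aesm : AEStronglyMeasurable u (volume.restrict (slab T))
  aesm_grad : ∀ j, AEStronglyMeasurable (Du j) (volume.restrict (slab T))
  weakGrad : ∀ᵐ t ∂(volume.restrict (Icc (0 : ℝ) T)), ∀ j,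
    IsWeakPartial j (fun x => u (x, t)) (fun x => Du j (x, t))
  linfL2_lt_top : normLinfL2 (slab T) u < ∞
  l2H1_lt_top : normL2H1 T u Du < ∞

/-- Convergence `u_k → u` in `L¹_loc(D)`. -/
def TendstoL1loc (T : ℝ) (u : ℕ → SpaceTime → R4) (v : SpaceTime → R4) : Prop :=
  ∀ K : Set SpaceTime, IsCompact K → K ⊆ slab T →
    Tendsto (fun k => ∫⁻ z in K, ‖u k z - v z‖ₑ) atTop (𝓝 0)

/-- The measure `|∇u|² dx dt` on `D`. -/
def gradMeasure (T : ℝ) (Du : Fin 4 → SpaceTime → R4) : Measure SpaceTime :=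
  (volume.restrict (slab T)).withDensity (fun z => ENNReal.ofReal (gradSq Du z))

/-- The measure `|u|³ dx dt` on `D`. -/
def cubeMeasure (T : ℝ) (u : SpaceTime → R4) : Measure SpaceTime :=
  (volume.restrict (slab T)).withDensity (fun z => ENNReal.ofReal (‖u z‖ ^ 3))

/-- Weak convergence in the sense of measures, tested with continuous compactly supported
functions. For measures carried by the closed set `D`, testing with the restrictions to `D` of
such functions on space-time is the same as testing with all of `C_c(D)`, including
functions that do not vanish at `t = 0` or `t = T`. -/
def TendstoWeakly (m : ℕ → Measure SpaceTime) (m' : Measure SpaceTime) : Prop :=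
  ∀ φ : SpaceTime → ℝ, Continuous φ → HasCompactSupport φ →
    Tendsto (fun k => ∫ z, φ z ∂(m k)) atTop (𝓝 (∫ z, φ z ∂m'))

/-- The centred parabolic cylinder `Q*_r(x₀, t₀) = B_r(x₀) × (t₀ - r²/2, t₀ + r²/2)`. -/
def cyl (r : ℝ) (z : SpaceTime) : Set SpaceTime :=
  Metric.ball z.1 r ×ˢ Ioo (z.2 - r ^ 2 / 2) (z.2 + r ^ 2 / 2)

end ParabolicCC

end

/-! Put `w k = u k - v`. This sequence is bounded in the energy space and tends to `0` in `L¹_loc`.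
A local `L³` bound and interpolation make it vanish in `L²_loc`. Moving spatial derivatives onto
test functions, followed by density in `L²`, makes its gradients converge weakly to `0` in `L²`.

Expanding `|∇(w k)|²` then leaves no cross term in the limit, so `∫ φ |∇(w k)|²` tends to `∫ φ dμ -
∫ φ |∇v|²` (`tendsto_integral_gradSq_sub`). For `φ ≥ 0` this limit is nonnegative, so `λ = μ -
|∇v|²` is a positive measure. Fatou's lemma does the same for `ω = ν - |v|³`
(`lintegral_cubeMeasure_le`) and also yields integrability of `|v|³`. Conversely, a one-sided
Brezis–Lieb argument bounds `∫ ψ dω` by four times any limit of upper bounds for `∫ ψ |w k|³` along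
a subsequence (`integral_le_of_subseq_cube_le`). Losing the factor `4` is harmless, as the final
constant is unspecified.

The two defects are linked by `∫ |f|³ ≤ C ‖f‖_{L²} ∫ |∇f|²` on `ℝ⁴`, which is `L²`–`L⁴`
interpolation combined with the critical Sobolev inequality. It is applied to `φ w k` on each time
slice and integrated in time. The term in which the derivative hits `φ` disappears by `L²_loc`
convergence, leaving `∫ φ³ dω ≤ C a ∫ φ² dλ` whenever `φ` lives in `O` and `a` exceeds the lower
limit of the norms on `O ∩ D` (`exists_defect_le`).

Regularity of finite measures turns this into the estimate on open sets, and the uniform energy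
bound then gives `ω ≪ λ`. The density bound needs no differentiation theorem: it holds almost
everywhere on each member of a countable basis, and every cylinder around a point contains a basic
neighbourhood of that point. -/

namespace ParabolicCC

/-! ### Inequalities for lower integrals -/

section Lintegral

variable {α : Type*} [MeasurableSpace α] {m : Measure α}

theorem sq_lintegral_mul_le {f g : α → ℝ≥0∞} (hf : AEMeasurable f m) (hg : AEMeasurable g m) :
    (∫⁻ a, f a * g a ∂m) ^ 2 ≤ (∫⁻ a, f a ^ 2 ∂m) * ∫⁻ a, g a ^ 2 ∂m := by
  have h := ENNReal.lintegral_mul_le_Lp_mul_Lq m Real.HolderConjugate.two_two hf hg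
  simp only [Pi.mul_apply, ENNReal.rpow_two] at h
  calc (∫⁻ a, f a * g a ∂m) ^ 2
      ≤ ((∫⁻ a, f a ^ 2 ∂m) ^ (1 / 2 : ℝ) * (∫⁻ a, g a ^ 2 ∂m) ^ (1 / 2 : ℝ)) ^ 2 := by gcongr
    _ = _ := by
      rw [mul_pow]
      simp only [← ENNReal.rpow_natCast, ← ENNReal.rpow_mul]
      norm_num

/-- Cauchy–Schwarz for the measure `r dm`, by splitting `r` into two square roots. With `∫ r = 1` it
is Jensen's inequality for mollifiers; with `r = g` it interpolates `L²` between `L¹` and `L³`. -/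
theorem sq_lintegral_mul_le_weighted {r g : α → ℝ≥0∞} (hr : AEMeasurable r m)
    (hg : AEMeasurable g m) :
    (∫⁻ a, r a * g a ∂m) ^ 2 ≤ (∫⁻ a, r a ∂m) * ∫⁻ a, r a * g a ^ 2 ∂m := by
  have hs : ∀ a, r a ^ (1 / 2 : ℝ) * r a ^ (1 / 2 : ℝ) = r a := fun a => by
    rw [← ENNReal.rpow_add_of_nonneg _ _ (by norm_num) (by norm_num)]; norm_num
  have h := sq_lintegral_mul_le (m := m) (f := fun a => r a ^ (1 / 2 : ℝ))
    (g := fun a => r a ^ (1 / 2 : ℝ) * g a) (hr.pow_const _) ((hr.pow_const _).mul hg)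
  have e1 : ∀ a, r a ^ (1 / 2 : ℝ) * (r a ^ (1 / 2 : ℝ) * g a) = r a * g a := fun a => by
    rw [← mul_assoc, hs]
  have e2 : ∀ a, (r a ^ (1 / 2 : ℝ) * g a) ^ 2 = r a * g a ^ 2 := fun a => by
    rw [mul_pow, pow_two (r a ^ _), hs]
  have e3 : ∀ a, (r a ^ (1 / 2 : ℝ)) ^ 2 = r a := fun a => by rw [pow_two, hs]
  simpa only [e1, e2, e3] using h

end Lintegral

theorem sq_eLpNorm_two {α E : Type*} [MeasurableSpace α] {m : Measure α} [NormedAddCommGroup E]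
    (f : α → E) : eLpNorm f 2 m ^ 2 = ∫⁻ x, ‖f x‖ₑ ^ 2 ∂m := by
  have := eLpNorm_nnreal_pow_eq_lintegral (f := f) (μ := m) (p := 2) two_ne_zero
  simpa using this

theorem pow_four_eLpNorm {α E : Type*} [MeasurableSpace α] {m : Measure α} [NormedAddCommGroup E]
    (f : α → E) : eLpNorm f 4 m ^ 4 = ∫⁻ x, ‖f x‖ₑ ^ 4 ∂m := by
  have := eLpNorm_nnreal_pow_eq_lintegral (f := f) (μ := m) (p := 4) four_ne_zero
  rw [← ENNReal.rpow_natCast]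
  simp only [← ENNReal.rpow_natCast]
  simpa using this

/-- Interpolation of the cube between `L²` and `L⁴`. -/
theorem lintegral_cube_le {α E : Type*} [MeasurableSpace α] {m : Measure α} [NormedAddCommGroup E]
    {f : α → E} (hf : AEStronglyMeasurable f m) :
    ∫⁻ x, ‖f x‖ₑ ^ 3 ∂m ≤ eLpNorm f 2 m * eLpNorm f 4 m ^ 2 := by
  have h := sq_lintegral_mul_le (m := m) hf.enorm (hf.enorm.pow_const 2)
  have h' : (∫⁻ x, ‖f x‖ₑ ^ 3 ∂m) ^ 2 ≤ (eLpNorm f 2 m * eLpNorm f 4 m ^ 2) ^ 2 := by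
    rw [mul_pow, ← pow_mul, sq_eLpNorm_two, pow_four_eLpNorm]
    convert h using 3
    · funext a; ring
    · simp only [← pow_mul]
  exact (ENNReal.pow_le_pow_left_iff two_ne_zero).1 h'

/-! ### Weak partial derivatives on `ℝ⁴` -/

theorem locallyIntegrable_smul {a : R4 → ℝ} {f : R4 → R4} (ha : Continuous a)
    (hf : LocallyIntegrable f volume) : LocallyIntegrable (fun x => a x • f x) volume := by
  rw [← locallyIntegrableOn_univ] at hf ⊢
  exact hf.continuousOn_smul isOpen_univ.isLocallyClosed ha.continuousOn

theorem continuous_fderiv_apply {a : R4 → ℝ} (ha : ContDiff ℝ ((⊤ : ℕ∞) : WithTop ℕ∞) a) (e : R4) :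
    Continuous fun x => fderiv ℝ a x e :=
  (ha.continuous_fderiv (by simp)).clm_apply continuous_const

theorem IsWeakPartial.sub {j : Fin 4} {f₁ f₂ g₁ g₂ : R4 → R4} (h₁ : IsWeakPartial j f₁ g₁)
    (h₂ : IsWeakPartial j f₂ g₂) :
    IsWeakPartial j (fun x => f₁ x - f₂ x) (fun x => g₁ x - g₂ x) := by
  refine ⟨h₁.1.sub h₂.1, h₁.2.1.sub h₂.2.1, fun ψ hψ hc => ?_⟩
  have hd : HasCompactSupport fun x => fderiv ℝ ψ x (EuclideanSpace.single j 1) :=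
    hc.fderiv_apply ℝ _
  have hdc := continuous_fderiv_apply hψ (EuclideanSpace.single j 1)
  simp only [smul_sub]
  rw [integral_sub (h₁.1.integrable_smul_left_of_hasCompactSupport hdc hd)
      (h₂.1.integrable_smul_left_of_hasCompactSupport hdc hd),
    integral_sub (h₁.2.1.integrable_smul_left_of_hasCompactSupport hψ.continuous hc)
      (h₂.2.1.integrable_smul_left_of_hasCompactSupport hψ.continuous hc),
    h₁.2.2 ψ hψ hc, h₂.2.2 ψ hψ hc]
  abel

/-- The product rule for the weak derivative of `a f`, with `a` smooth. -/
theorem IsWeakPartial.smul {j : Fin 4} {f g : R4 → R4} (h : IsWeakPartial j f g) {a : R4 → ℝ}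
    (ha : ContDiff ℝ ((⊤ : ℕ∞) : WithTop ℕ∞) a) :
    IsWeakPartial j (fun x => a x • f x)
      (fun x => a x • g x + fderiv ℝ a x (EuclideanSpace.single j 1) • f x) := by
  set e : R4 := EuclideanSpace.single j 1 with he
  have hdac := continuous_fderiv_apply ha e
  refine ⟨locallyIntegrable_smul ha.continuous h.1,
    (locallyIntegrable_smul ha.continuous h.2.1).add (locallyIntegrable_smul hdac h.1),
    fun ψ hψ hc => ?_⟩
  have hdc : HasCompactSupport fun x => fderiv ℝ ψ x e := hc.fderiv_apply ℝ _
  have hψc := continuous_fderiv_apply hψ e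
  have key := h.2.2 (fun x => ψ x * a x) (hψ.mul ha) hc.mul_right
  have i1 : Integrable (fun x => (fderiv ℝ ψ x e * a x) • f x) volume :=
    h.1.integrable_smul_left_of_hasCompactSupport (hψc.mul ha.continuous) hdc.mul_right
  have i2 : Integrable (fun x => (ψ x * fderiv ℝ a x e) • f x) volume :=
    h.1.integrable_smul_left_of_hasCompactSupport (hψ.continuous.mul hdac) hc.mul_right
  have i3 : Integrable (fun x => (ψ x * a x) • g x) volume :=
    h.2.1.integrable_smul_left_of_hasCompactSupport (hψ.continuous.mul ha.continuous) hc.mul_right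
  have hfd : ∀ x, fderiv ℝ (fun x => ψ x * a x) x e
      = fderiv ℝ ψ x e * a x + ψ x * fderiv ℝ a x e := fun x => by
    rw [fderiv_fun_mul (hψ.differentiable (by simp) x) (ha.differentiable (by simp) x)]
    simp; ring
  simp only [← he, hfd, add_smul] at key
  rw [integral_add i1 i2] at key
  simp only [smul_add, smul_smul]
  rw [integral_add i3 i2, neg_add, ← key]
  abel

/-! ### Mollification -/

/-- A mollifier supported in the ball of radius `2 / (n + 1)`. -/
noncomputable def mollifier (n : ℕ) : ContDiffBump (0 : R4) :=
  ⟨1 / (n + 1), 2 / (n + 1), by positivity, by gcongr; norm_num⟩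

/-- The mollified function `ρₙ ⋆ f`. -/
noncomputable def mollify (n : ℕ) (f : R4 → R4) : R4 → R4 :=
  MeasureTheory.convolution ((mollifier n).normed volume) f (ContinuousLinearMap.lsmul ℝ ℝ) volume

theorem mollify_apply (n : ℕ) (f : R4 → R4) (x : R4) :
    mollify n f x = ∫ y, (mollifier n).normed volume (x - y) • f y := by
  rw [mollify, convolution_lsmul_swap]

theorem contDiff_mollify (n : ℕ) {f : R4 → R4} (hf : LocallyIntegrable f volume) :
    ContDiff ℝ ((⊤ : ℕ∞) : WithTop ℕ∞) (mollify n f) :=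
  (mollifier n).hasCompactSupport_normed.contDiff_convolution_left _
    (mollifier n).contDiff_normed hf

theorem hasCompactSupport_mollify (n : ℕ) {f : R4 → R4} (hf : HasCompactSupport f) :
    HasCompactSupport (mollify n f) :=
  (mollifier n).hasCompactSupport_normed.convolution _ hf

theorem ae_tendsto_mollify {f : R4 → R4} (hf : LocallyIntegrable f volume) :
    ∀ᵐ x, Tendsto (fun n => mollify n f x) atTop (𝓝 (f x)) := by
  -- `K = 2` is the fixed ratio of outer to inner radius of the mollifiers.
  refine ContDiffBump.ae_convolution_tendsto_right_of_locallyIntegrable (K := 2) ?_ ?_ hf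
  · have h := (tendsto_one_div_add_atTop_nhds_zero_nat (𝕜 := ℝ)).const_mul 2
    simp only [mul_zero] at h
    refine h.congr fun n => ?_
    simp only [mollifier]; ring
  · refine Eventually.of_forall fun n => le_of_eq ?_
    simp only [mollifier]; ring

/-- The derivative falls on the kernel, and `y ↦ ρ (x - y)` is itself a test function for the weak
derivative. The sign from reflecting the kernel cancels the sign from integrating by parts. -/
theorem fderiv_mollify (n : ℕ) {j : Fin 4} {f g : R4 → R4} (h : IsWeakPartial j f g) (x : R4) :
    fderiv ℝ (mollify n f) x (EuclideanSpace.single j 1) = mollify n g x := by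
  set e : R4 := EuclideanSpace.single j 1 with he
  set ρ := (mollifier n).normed (volume : Measure R4) with hρ
  have hρs : ContDiff ℝ ((⊤ : ℕ∞) : WithTop ℕ∞) ρ := (mollifier n).contDiff_normed
  have hρc : HasCompactSupport ρ := (mollifier n).hasCompactSupport_normed
  have hd := hρc.hasFDerivAt_convolution_left (ContinuousLinearMap.lsmul ℝ ℝ)
    (hρs.of_le (by simp)) h.1 x (μ := volume)
  have hd' : fderiv ℝ (mollify n f) x = _ := hd.fderiv
  have hex : ConvolutionExistsAt (fderiv ℝ ρ) f x
      ((ContinuousLinearMap.lsmul ℝ ℝ : ℝ →L[ℝ] R4 →L[ℝ] R4).precompL R4) volume :=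
    (hρc.fderiv ℝ).convolutionExists_left _ (hρs.continuous_fderiv (by simp)) h.1 x
  have hps : ContDiff ℝ ((⊤ : ℕ∞) : WithTop ℕ∞) fun y => ρ (x - y) :=
    hρs.comp (contDiff_const.sub contDiff_id)
  have hpc : HasCompactSupport fun y => ρ (x - y) :=
    hρc.comp_homeomorph (Homeomorph.subLeft x)
  have hfd : ∀ y, fderiv ℝ (fun y => ρ (x - y)) y e = - fderiv ℝ ρ (x - y) e := fun y => by
    have h1 : HasFDerivAt (fun y => x - y) (-ContinuousLinearMap.id ℝ R4) y :=
      (hasFDerivAt_id y).const_sub x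
    have h2 := ((hρs.differentiable (by simp) (x - y)).hasFDerivAt).comp y h1
    have h3 : fderiv ℝ (fun y => ρ (x - y)) y = _ := h2.fderiv
    rw [h3]; simp
  have key := h.2.2 _ hps hpc
  simp only [← he, hfd, neg_smul, integral_neg, neg_inj] at key
  rw [hd', convolution_eq_swap, ContinuousLinearMap.integral_apply hex.integrable_swap,
    mollify_apply, ← key]
  rfl

/-- Jensen's inequality pointwise, since the kernel has mass one, then Tonelli and translation
invariance. -/
theorem eLpNorm_mollify_le (n : ℕ) {g : R4 → R4} (hg : AEStronglyMeasurable g volume) :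
    eLpNorm (mollify n g) 2 volume ≤ eLpNorm g 2 volume := by
  refine (ENNReal.pow_le_pow_left_iff two_ne_zero).1 ?_
  rw [sq_eLpNorm_two, sq_eLpNorm_two]
  set ρ := (mollifier n).normed (volume : Measure R4) with hρ
  have hρm : Measurable fun y => ‖ρ y‖ₑ := (mollifier n).continuous_normed.enorm.measurable
  have hone : ∫⁻ y, ‖ρ y‖ₑ = 1 := by
    have h := ofReal_integral_norm_eq_lintegral_enorm
      ((mollifier n).integrable_normed (μ := (volume : Measure R4)))
    rw [← hρ] at h
    rw [← h]
    have : ∀ y, ‖ρ y‖ = ρ y := fun y => Real.norm_of_nonneg ((mollifier n).nonneg_normed y)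
    simp only [this]
    rw [hρ, (mollifier n).integral_normed, ENNReal.ofReal_one]
  have hleft : ∀ x, ∫⁻ y, ‖ρ (x - y)‖ₑ = 1 := fun x => by
    rw [← hone]; exact lintegral_sub_left_eq_self (fun y => ‖ρ y‖ₑ) x
  have hright : ∀ y, ∫⁻ x, ‖ρ (x - y)‖ₑ = 1 := fun y => by
    rw [← hone]; exact lintegral_sub_right_eq_self (fun y => ‖ρ y‖ₑ) y
  calc ∫⁻ x, ‖mollify n g x‖ₑ ^ 2
      ≤ ∫⁻ x, ∫⁻ y, ‖ρ (x - y)‖ₑ * ‖g y‖ₑ ^ 2 := by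
        refine lintegral_mono fun x => ?_
        have h := sq_lintegral_mul_le_weighted (m := volume) (r := fun y => ‖ρ (x - y)‖ₑ)
          (hρm.comp (measurable_const.sub measurable_id)).aemeasurable hg.enorm
        rw [hleft, one_mul] at h
        refine le_trans ?_ h
        gcongr
        rw [mollify_apply]
        refine (enorm_integral_le_lintegral_enorm _).trans (le_of_eq ?_)
        simp only [enorm_smul, ← hρ]
    _ = ∫⁻ y, ∫⁻ x, ‖ρ (x - y)‖ₑ * ‖g y‖ₑ ^ 2 := by
        refine lintegral_lintegral_swap ?_
        exact (hρm.comp (measurable_fst.sub measurable_snd)).aemeasurable.mul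
          (hg.enorm.pow_const 2).comp_snd
    _ = ∫⁻ y, ‖g y‖ₑ ^ 2 := by
        refine lintegral_congr fun y => ?_
        rw [lintegral_mul_const _ (f := fun x => ‖ρ (x - y)‖ₑ)
          (hρm.comp (measurable_id.sub_const y)), hright, one_mul]

/-! ### Sobolev and Gagliardo–Nirenberg inequalities -/

theorem opNorm_le_sum_single (A : R4 →L[ℝ] R4) : ‖A‖ ≤ ∑ j, ‖A (EuclideanSpace.single j 1)‖ := by
  refine A.opNorm_le_bound (Finset.sum_nonneg fun _ _ => norm_nonneg _) fun x => ?_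
  have hx : x = ∑ j, x j • (EuclideanSpace.single j (1 : ℝ) : R4) := by
    ext i; simp [Finset.sum_apply, Pi.single_apply]
  calc ‖A x‖ = ‖∑ j, x j • A (EuclideanSpace.single j 1)‖ := by
        conv_lhs => rw [hx]
        simp only [map_sum, map_smul]
    _ ≤ ∑ j, ‖A (EuclideanSpace.single j 1)‖ * ‖x‖ := by
        refine (norm_sum_le _ _).trans (Finset.sum_le_sum fun j _ => ?_)
        rw [norm_smul, mul_comm]
        gcongr
        exact PiLp.norm_apply_le x j
    _ = _ := (Finset.sum_mul _ _ _).symm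

/-- The Sobolev inequality `‖f‖_{L⁴} ≤ C ‖∇f‖_{L²}` on `ℝ⁴`. -/
theorem exists_sobolev_const : ∃ C : ℝ≥0, ∀ (f : R4 → R4) (g : Fin 4 → R4 → R4),
    (∀ j, IsWeakPartial j f (g j)) → HasCompactSupport f →
      eLpNorm f 4 volume ≤ C * ∑ j, eLpNorm (g j) 2 volume := by
  refine ⟨eLpNormLESNormFDerivOfEqInnerConst (volume : Measure R4) (2 : ℝ≥0),
    fun f g h hc => ?_⟩
  set C := eLpNormLESNormFDerivOfEqInnerConst (volume : Measure R4) (2 : ℝ≥0)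
  have hf : LocallyIntegrable f volume := (h 0).1
  -- The smooth inequality with `1/4 = 1/2 - 1/4` applies to the mollifications, which keep compact
  -- support and whose gradients are mollified weak gradients. Fatou then removes the mollification.
  have hbound : ∀ n, eLpNorm (mollify n f) 4 volume ≤ C * ∑ j, eLpNorm (g j) 2 volume := by
    intro n
    have hs := eLpNorm_le_eLpNorm_fderiv_of_eq_inner (volume : Measure R4)
      ((contDiff_mollify n hf).of_le (by simp)) (hasCompactSupport_mollify n hc)
      (p := 2) (p' := 4) (by norm_num) (by simp) (by simp; norm_num)
    refine hs.trans ?_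
    gcongr
    calc eLpNorm (fderiv ℝ (mollify n f)) 2 volume
        ≤ eLpNorm (fun x => ∑ j, ‖mollify n (g j) x‖) 2 volume := by
          refine eLpNorm_mono_real fun x => ?_
          refine (opNorm_le_sum_single _).trans_eq ?_
          simp only [fderiv_mollify n (h _)]
      _ ≤ ∑ j, eLpNorm (fun x => ‖mollify n (g j) x‖) 2 volume := by
          have := eLpNorm_sum_le (μ := volume) (p := 2) (s := Finset.univ)
            (f := fun j x => ‖mollify n (g j) x‖)
            (fun j _ => (contDiff_mollify n (h j).2.1).continuous.norm.aestronglyMeasurable)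
            (by norm_num)
          refine le_trans (le_of_eq ?_) this
          congr 1
      _ ≤ ∑ j, eLpNorm (g j) 2 volume := by
          refine Finset.sum_le_sum fun j _ => ?_
          rw [eLpNorm_norm]
          exact eLpNorm_mollify_le n (h j).2.1.aestronglyMeasurable
  have := Lp.eLpNorm_lim_le_liminf_eLpNorm (p := 4) (f := fun n => mollify n f)
    (fun n => (contDiff_mollify n hf).continuous.aestronglyMeasurable) f (ae_tendsto_mollify hf)
  refine this.trans ?_
  refine (liminf_le_liminf (Eventually.of_forall hbound)).trans ?_
  simp

/-- `∫ |f|³ ≤ C ‖f‖_{L²} ∫ |∇f|²` on `ℝ⁴`. -/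
theorem exists_cube_const : ∃ C : ℝ≥0, ∀ (f : R4 → R4) (g : Fin 4 → R4 → R4),
    (∀ j, IsWeakPartial j f (g j)) → HasCompactSupport f →
      ∫⁻ x, ‖f x‖ₑ ^ 3 ≤ C * eLpNorm f 2 volume * ∫⁻ x, ∑ j, ‖g j x‖ₑ ^ 2 := by
  obtain ⟨C, hC⟩ := exists_sobolev_const
  -- The Sobolev constant is squared; `4` comes from Cauchy–Schwarz over the four partial
  -- derivatives.
  refine ⟨C ^ 2 * 4, fun f g h hc => ?_⟩
  refine (lintegral_cube_le (h 0).1.aestronglyMeasurable).trans ?_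
  have hsq : (∑ j, eLpNorm (g j) 2 volume) ^ 2 ≤ 4 * ∑ j, eLpNorm (g j) 2 volume ^ 2 := by
    have := ENNReal.inner_le_Lp_mul_Lq (Finset.univ : Finset (Fin 4)) (fun _ => 1)
      (fun j => eLpNorm (g j) 2 volume) Real.HolderConjugate.two_two
    simp only [one_mul, ENNReal.rpow_two, one_pow, Finset.sum_const, Finset.card_univ,
      Fintype.card_fin] at this
    calc (∑ j, eLpNorm (g j) 2 volume) ^ 2 ≤ _ := pow_le_pow_left' this 2
      _ = _ := by
        rw [mul_pow]
        simp only [← ENNReal.rpow_natCast, ← ENNReal.rpow_mul]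
        norm_num
  calc eLpNorm f 2 volume * eLpNorm f 4 volume ^ 2
      ≤ eLpNorm f 2 volume * (C * ∑ j, eLpNorm (g j) 2 volume) ^ 2 := by gcongr; exact hC f g h hc
    _ ≤ eLpNorm f 2 volume * (C ^ 2 * (4 * ∑ j, eLpNorm (g j) 2 volume ^ 2)) := by
        rw [mul_pow]; gcongr
    _ = _ := by
        simp only [sq_eLpNorm_two]
        rw [lintegral_finsetSum' _ fun j _ =>
          ((h j).2.1.aestronglyMeasurable.enorm.pow_const 2)]
        push_cast; ring

/-! ### Test functions on space-time and their time slices -/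

theorem measurableSet_slab (T : ℝ) : MeasurableSet (slab T) :=
  MeasurableSet.univ.prod measurableSet_Icc

theorem restrict_slab (T : ℝ) : (volume : Measure SpaceTime).restrict (slab T)
    = (volume : Measure R4).prod (volume.restrict (Icc (0 : ℝ) T)) := by
  rw [slab, Measure.volume_eq_prod, ← Measure.prod_restrict, Measure.restrict_univ]

/-- A smooth compactly supported function on space-time. -/
structure IsTest (φ : SpaceTime → ℝ) : Prop where
  contDiff : ContDiff ℝ ((⊤ : ℕ∞) : WithTop ℕ∞) φ
  hasCompactSupport : HasCompactSupport φ

/-- The classical spatial partial derivative `∂ⱼφ`. -/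
noncomputable def pd (j : Fin 4) (φ : SpaceTime → ℝ) (z : SpaceTime) : ℝ :=
  fderiv ℝ φ z (EuclideanSpace.single j 1, 0)

theorem pd_of_notMem_tsupport (j : Fin 4) {φ : SpaceTime → ℝ} {z : SpaceTime}
    (hz : z ∉ tsupport φ) : pd j φ z = 0 := by
  rw [pd, fderiv_of_notMem_tsupport ℝ hz]; rfl

namespace IsTest

variable {φ : SpaceTime → ℝ} (hφ : IsTest φ)
include hφ

theorem continuous : Continuous φ := hφ.contDiff.continuous

theorem continuous_pd (j : Fin 4) : Continuous (pd j φ) :=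
  (hφ.contDiff.continuous_fderiv (by simp)).clm_apply continuous_const

theorem hasCompactSupport_pd (j : Fin 4) : HasCompactSupport (pd j φ) :=
  hφ.hasCompactSupport.fderiv_apply ℝ _

theorem exists_bound : ∃ c : ℝ≥0, (∀ z, ‖φ z‖ ≤ c) ∧ ∀ j z, ‖pd j φ z‖ ≤ c := by
  obtain ⟨c₀, h₀⟩ := hφ.hasCompactSupport.exists_bound_of_continuous hφ.continuous
  have h : ∀ j, ∃ c, ∀ z, ‖pd j φ z‖ ≤ c := fun j =>
    (hφ.hasCompactSupport_pd j).exists_bound_of_continuous (hφ.continuous_pd j)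
  choose c hc using h
  refine ⟨(max c₀ (∑ j, |c j|)).toNNReal, fun z => ?_, fun j z => ?_⟩
  · exact ((h₀ z).trans (le_max_left _ _)).trans (Real.le_coe_toNNReal _)
  · refine le_trans ((hc j z).trans ?_) (Real.le_coe_toNNReal _)
    exact ((le_abs_self _).trans (Finset.single_le_sum (f := fun j => |c j|)
      (fun _ _ => abs_nonneg _) (Finset.mem_univ j))).trans (le_max_right _ _)

theorem contDiff_slice (t : ℝ) : ContDiff ℝ ((⊤ : ℕ∞) : WithTop ℕ∞) fun x : R4 => φ (x, t) :=
  hφ.contDiff.comp (contDiff_id.prodMk contDiff_const)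

theorem hasCompactSupport_slice (t : ℝ) : HasCompactSupport fun x : R4 => φ (x, t) :=
  hφ.hasCompactSupport.comp_isClosedEmbedding
    (Function.LeftInverse.isClosedEmbedding (f := Prod.fst) (g := fun x : R4 => (x, t))
      (fun _ => rfl) continuous_fst (by fun_prop))

theorem fderiv_slice (j : Fin 4) (x : R4) (t : ℝ) :
    fderiv ℝ (fun x : R4 => φ (x, t)) x (EuclideanSpace.single j 1) = pd j φ (x, t) := by
  have h1 : HasFDerivAt (fun x : R4 => (x, t)) (ContinuousLinearMap.inl ℝ R4 ℝ) x :=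
    hasFDerivAt_prodMk_left x t
  have h2 := ((hφ.contDiff.differentiable (by simp) (x, t)).hasFDerivAt).comp x h1
  have h3 : fderiv ℝ (fun x : R4 => φ (x, t)) x = _ := h2.fderiv
  rw [h3]; simp [pd]

end IsTest

/-! ### Functions with weak spatial gradient on the slab -/

/-- `w` is measurable on the slab with weak spatial gradient `Dw`. -/
structure HasWeakGrad (T : ℝ) (w : SpaceTime → R4) (Dw : Fin 4 → SpaceTime → R4) : Prop where
  aesm : AEStronglyMeasurable w (volume.restrict (slab T))
  aesm_grad : ∀ j, AEStronglyMeasurable (Dw j) (volume.restrict (slab T))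
  weakGrad : ∀ᵐ t ∂(volume.restrict (Icc (0 : ℝ) T)), ∀ j,
    IsWeakPartial j (fun x => w (x, t)) (fun x => Dw j (x, t))

theorem IsEnergyClass.hasWeakGrad {T : ℝ} {w : SpaceTime → R4} {Dw : Fin 4 → SpaceTime → R4}
    (h : IsEnergyClass T w Dw) : HasWeakGrad T w Dw := ⟨h.aesm, h.aesm_grad, h.weakGrad⟩

theorem HasWeakGrad.sub {T : ℝ} {w₁ w₂ : SpaceTime → R4} {D₁ D₂ : Fin 4 → SpaceTime → R4}
    (h₁ : HasWeakGrad T w₁ D₁) (h₂ : HasWeakGrad T w₂ D₂) :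
    HasWeakGrad T (w₁ - w₂) (D₁ - D₂) := by
  refine ⟨h₁.aesm.sub h₂.aesm, fun j => (h₁.aesm_grad j).sub (h₂.aesm_grad j), ?_⟩
  filter_upwards [h₁.weakGrad, h₂.weakGrad] with t a b j
  exact (a j).sub (b j)

/-- The space-time inequality
`∬ |φw|³ ≤ C ‖w‖_{L^∞ L²(O ∩ D)} ∬ |∇(φw)|²` for `φ` vanishing outside `O`. -/
theorem exists_lintegral_cube_le : ∃ C : ℝ≥0, ∀ (T : ℝ) (w : SpaceTime → R4)
    (Dw : Fin 4 → SpaceTime → R4), HasWeakGrad T w Dw → ∀ φ : SpaceTime → ℝ, IsTest φ →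
    (∀ z, ‖φ z‖ ≤ 1) → ∀ O : Set SpaceTime, IsOpen O → (∀ z, z ∉ O → φ z = 0) →
    ∫⁻ z in slab T, ‖φ z • w z‖ₑ ^ 3 ≤ C * normLinfL2 (O ∩ slab T) w *
      ∫⁻ z in slab T, ∑ j, ‖φ z • Dw j z + pd j φ z • w z‖ₑ ^ 2 := by
  obtain ⟨C, hC⟩ := exists_cube_const
  refine ⟨C, fun T w Dw h φ hφ h1 O hO hsupp => ?_⟩
  have hmG : AEMeasurable (fun z => ∑ j, ‖φ z • Dw j z + pd j φ z • w z‖ₑ ^ 2)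
      (volume.restrict (slab T)) := by
    refine Finset.aemeasurable_fun_sum _ fun j _ => ?_
    exact (((hφ.continuous.aestronglyMeasurable.smul (h.aesm_grad j)).add
      ((hφ.continuous_pd j).aestronglyMeasurable.smul h.aesm)).enorm.pow_const 2)
  have hmF : AEMeasurable (fun z => ‖φ z • w z‖ₑ ^ 3) (volume.restrict (slab T)) :=
    (hφ.continuous.aestronglyMeasurable.smul h.aesm).enorm.pow_const 3
  rw [restrict_slab] at hmG hmF ⊢
  rw [lintegral_prod_symm _ hmF, lintegral_prod_symm _ hmG,
    ← lintegral_const_mul'' _ hmG.lintegral_prod_left']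
  refine lintegral_mono_ae ?_
  -- Only spatial derivatives occur, so the inequality on `ℝ⁴` is used for almost every fixed `t`;
  -- the `L²` factor is bounded by its essential supremum.
  filter_upwards [h.weakGrad, ae_restrict_mem measurableSet_Icc,
    ae_restrict_of_ae (ENNReal.ae_le_essSup (fun t : ℝ => eLpNorm (fun x : R4 => w (x, t)) 2
      (volume.restrict {x : R4 | (x, t) ∈ O ∩ slab T})))] with t hw ht hess
  have hslice := hC (fun x => φ (x, t) • w (x, t))
    (fun j x => φ (x, t) • Dw j (x, t) + pd j φ (x, t) • w (x, t))
    (fun j => by simpa only [hφ.fderiv_slice] using (hw j).smul (hφ.contDiff_slice t))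
    (hφ.hasCompactSupport_slice t).smul_right
  refine hslice.trans ?_
  gcongr
  refine le_trans ?_ hess
  have hS : MeasurableSet {x : R4 | (x, t) ∈ O ∩ slab T} :=
    (hO.measurableSet.inter (measurableSet_slab T)).preimage (by fun_prop)
  rw [← eLpNorm_indicator_eq_eLpNorm_restrict hS]
  refine eLpNorm_mono fun x => ?_
  by_cases hx : (x, t) ∈ O
  · rw [indicator_of_mem (show x ∈ {x : R4 | (x, t) ∈ O ∩ slab T} from ⟨hx, mem_univ _, ht⟩),
      norm_smul]
    exact mul_le_of_le_one_left (norm_nonneg _) (h1 _)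
  · simp [hsupp _ hx]

/-- Weak derivatives may be tested with smooth functions on space-time that need not vanish at the
initial and final times. -/
theorem HasWeakGrad.integral_smul {T : ℝ} {w : SpaceTime → R4} {Dw : Fin 4 → SpaceTime → R4}
    (h : HasWeakGrad T w Dw) (j : Fin 4) {ψ : SpaceTime → ℝ} (hψ : IsTest ψ)
    (hw : LocallyIntegrable w (volume.restrict (slab T)))
    (hD : LocallyIntegrable (Dw j) (volume.restrict (slab T))) :
    ∫ z in slab T, ψ z • Dw j z = - ∫ z in slab T, pd j ψ z • w z := by
  have i1 := hD.integrable_smul_left_of_hasCompactSupport hψ.continuous hψ.hasCompactSupport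
  have i2 := hw.integrable_smul_left_of_hasCompactSupport (hψ.continuous_pd j)
    (hψ.hasCompactSupport_pd j)
  rw [restrict_slab] at i1 i2 ⊢
  rw [integral_prod_symm _ i1, integral_prod_symm _ i2, ← integral_neg]
  refine integral_congr_ae ?_
  filter_upwards [h.weakGrad] with t ht
  have := (ht j).2.2 _ (hψ.contDiff_slice t) (hψ.hasCompactSupport_slice t)
  simp only [hψ.fderiv_slice] at this
  rw [this, neg_neg]

/-! ### Norm estimates -/

theorem ofReal_energy_eq (Dw : Fin 4 → SpaceTime → R4) (w : SpaceTime → R4) (z : SpaceTime) :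
    ENNReal.ofReal (‖w z‖ ^ 2 + gradSq Dw z) = ‖w z‖ₑ ^ 2 + ∑ j, ‖Dw j z‖ₑ ^ 2 := by
  rw [gradSq, ENNReal.ofReal_add (by positivity) (by positivity),
    ENNReal.ofReal_sum_of_nonneg fun _ _ => by positivity]
  simp [ENNReal.ofReal_pow, ofReal_norm]

theorem lintegral_energy_eq (T : ℝ) (w : SpaceTime → R4) (Dw : Fin 4 → SpaceTime → R4) :
    ∫⁻ z in slab T, (‖w z‖ₑ ^ 2 + ∑ j, ‖Dw j z‖ₑ ^ 2) = normL2H1 T w Dw ^ 2 := by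
  simp only [normL2H1, ofReal_energy_eq, ← ENNReal.rpow_natCast, ← ENNReal.rpow_mul]
  norm_num

theorem enorm_sub_sq_le {E : Type*} [NormedAddCommGroup E] (a b : E) :
    ‖a - b‖ₑ ^ 2 ≤ 2 * ‖a‖ₑ ^ 2 + 2 * ‖b‖ₑ ^ 2 := by
  calc ‖a - b‖ₑ ^ 2 ≤ (‖a‖ₑ + ‖b‖ₑ) ^ 2 := by gcongr; exact enorm_sub_le
    _ ≤ 2 * (‖a‖ₑ ^ 2 + ‖b‖ₑ ^ 2) := by
      have := ENNReal.rpow_add_le_mul_rpow_add_rpow ‖a‖ₑ ‖b‖ₑ (p := 2) (by norm_num)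
      norm_num at this
      exact this
    _ = _ := mul_add _ _ _

theorem enorm_add_sq_le {E : Type*} [NormedAddCommGroup E] (a b : E) :
    ‖a + b‖ₑ ^ 2 ≤ 2 * ‖a‖ₑ ^ 2 + 2 * ‖b‖ₑ ^ 2 := by
  simpa using enorm_sub_sq_le a (-b)

theorem lintegral_energy_sub_le {T : ℝ} {w₁ w₂ : SpaceTime → R4} {D₁ D₂ : Fin 4 → SpaceTime → R4}
    (h₁ : HasWeakGrad T w₁ D₁) :
    ∫⁻ z in slab T, (‖(w₁ - w₂) z‖ₑ ^ 2 + ∑ j, ‖(D₁ - D₂) j z‖ₑ ^ 2)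
      ≤ 2 * normL2H1 T w₁ D₁ ^ 2 + 2 * normL2H1 T w₂ D₂ ^ 2 := by
  rw [← lintegral_energy_eq, ← lintegral_energy_eq, ← lintegral_const_mul' _ _ (by simp),
    ← lintegral_const_mul' _ _ (by simp), ← lintegral_add_left']
  · refine lintegral_mono fun z => ?_
    calc _ ≤ (2 * ‖w₁ z‖ₑ ^ 2 + 2 * ‖w₂ z‖ₑ ^ 2)
          + ∑ j, (2 * ‖D₁ j z‖ₑ ^ 2 + 2 * ‖D₂ j z‖ₑ ^ 2) :=
          add_le_add (enorm_sub_sq_le _ _) (Finset.sum_le_sum fun j _ => enorm_sub_sq_le _ _)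
      _ = _ := by
          rw [Finset.sum_add_distrib, ← Finset.mul_sum, ← Finset.mul_sum]; ring
  · refine AEMeasurable.const_mul (AEMeasurable.add (h₁.aesm.enorm.pow_const 2) ?_) _
    exact Finset.aemeasurable_fun_sum _ fun j _ => (h₁.aesm_grad j).enorm.pow_const 2

theorem normLinfL2_sub_le {T : ℝ} {w₁ w₂ : SpaceTime → R4} {D₁ D₂ : Fin 4 → SpaceTime → R4}
    (h₁ : HasWeakGrad T w₁ D₁) (h₂ : HasWeakGrad T w₂ D₂) :
    normLinfL2 (slab T) (w₁ - w₂) ≤ normLinfL2 (slab T) w₁ + normLinfL2 (slab T) w₂ := by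
  refine essSup_le_of_ae_le _ ?_
  -- Measurability of the time slices, required by the triangle inequality, is taken from the local
  -- integrability contained in `IsWeakPartial`.
  have a₁ := (ae_restrict_iff' measurableSet_Icc).1 h₁.weakGrad
  have a₂ := (ae_restrict_iff' measurableSet_Icc).1 h₂.weakGrad
  filter_upwards [a₁, a₂, ENNReal.ae_le_essSup (fun t : ℝ => eLpNorm (fun x : R4 => w₁ (x, t)) 2
      (volume.restrict {x : R4 | (x, t) ∈ slab T})),
    ENNReal.ae_le_essSup (fun t : ℝ => eLpNorm (fun x : R4 => w₂ (x, t)) 2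
      (volume.restrict {x : R4 | (x, t) ∈ slab T}))] with t b₁ b₂ c₁ c₂
  by_cases ht : t ∈ Icc 0 T
  · exact (eLpNorm_sub_le (b₁ ht 0).1.aestronglyMeasurable.restrict
      (b₂ ht 0).1.aestronglyMeasurable.restrict (by norm_num)).trans (add_le_add c₁ c₂)
  · have : {x : R4 | (x, t) ∈ slab T} = ∅ := by
      ext x; simp only [slab, mem_prod, mem_univ, true_and, mem_ofPred_eq, mem_empty_iff_false]
      exact iff_of_false ht id
    simp [this]

theorem normLinfL2_mono {Q Q' : Set SpaceTime} (h : Q ⊆ Q') (w : SpaceTime → R4) :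
    normLinfL2 Q w ≤ normLinfL2 Q' w :=
  essSup_mono_ae (Eventually.of_forall fun t => eLpNorm_mono_measure _
    (Measure.restrict_mono (fun x (hx : (x, t) ∈ Q) => show (x, t) ∈ Q' from h hx) le_rfl))

/-! ### Bounded sequences in the energy space that vanish in `L¹_loc` -/

/-- A sequence bounded in the energy space and converging to `0` in `L¹_loc(D)`. -/
structure IsVanishing (T : ℝ) (w : ℕ → SpaceTime → R4) (Dw : ℕ → Fin 4 → SpaceTime → R4)
    (N E : ℝ≥0) : Prop where
  hasWeakGrad : ∀ k, HasWeakGrad T (w k) (Dw k)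
  normLinfL2_le : ∀ k, normLinfL2 (slab T) (w k) ≤ N
  energy_le : ∀ k, ∫⁻ z in slab T, (‖w k z‖ₑ ^ 2 + ∑ j, ‖Dw k j z‖ₑ ^ 2) ≤ E
  tendsto : ∀ K : Set SpaceTime, IsCompact K → K ⊆ slab T →
    Tendsto (fun k => ∫⁻ z in K, ‖w k z‖ₑ) atTop (𝓝 0)

theorem isClosed_slab (T : ℝ) : IsClosed (slab T) := isClosed_univ.prod isClosed_Icc

theorem memLp_two_of_lintegral_le {T : ℝ} {f : SpaceTime → R4} {E : ℝ≥0}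
    (hf : AEStronglyMeasurable f (volume.restrict (slab T)))
    (h : ∫⁻ z in slab T, ‖f z‖ₑ ^ 2 ≤ E) : MemLp f 2 (volume.restrict (slab T)) := by
  refine ⟨hf, ?_⟩
  have h2 : eLpNorm f 2 (volume.restrict (slab T)) ^ 2 < ∞ := by
    rw [sq_eLpNorm_two]; exact h.trans_lt ENNReal.coe_lt_top
  by_contra hcon
  simp [not_lt_top_iff.1 hcon] at h2

/-- The gradient of a cut-off function is controlled by the energy. -/
theorem sum_enorm_cutoff_sq_le {φ : SpaceTime → ℝ} {c : ℝ≥0}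
    (hc : ∀ j z, ‖pd j φ z‖ ≤ c) (w : SpaceTime → R4) (Dw : Fin 4 → SpaceTime → R4)
    (z : SpaceTime) :
    ∑ j, ‖φ z • Dw j z + pd j φ z • w z‖ₑ ^ 2
      ≤ 2 * (‖φ z‖ₑ ^ 2 * ∑ j, ‖Dw j z‖ₑ ^ 2) +
        8 * c ^ 2 * (tsupport φ).indicator (fun z => ‖w z‖ₑ ^ 2) z := by
  have hj : ∀ j, ‖φ z • Dw j z + pd j φ z • w z‖ₑ ^ 2
      ≤ 2 * (‖φ z‖ₑ ^ 2 * ‖Dw j z‖ₑ ^ 2) +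
        2 * (c ^ 2 * (tsupport φ).indicator (fun z => ‖w z‖ₑ ^ 2) z) := fun j => by
    refine (enorm_add_sq_le _ _).trans ?_
    rw [enorm_smul, enorm_smul, mul_pow, mul_pow]
    by_cases hz : z ∈ tsupport φ
    · rw [indicator_of_mem hz]
      gcongr
      rw [← ofReal_norm, ← ENNReal.ofReal_coe_nnreal]
      exact ENNReal.ofReal_le_ofReal (hc j z)
    · simp [pd_of_notMem_tsupport j hz]
  -- The constant `8` is the factor `2` summed over four directions.
  refine (Finset.sum_le_sum fun j _ => hj j).trans (le_of_eq ?_)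
  rw [Finset.sum_add_distrib, ← Finset.mul_sum, ← Finset.mul_sum]
  simp only [Finset.sum_const, Finset.card_univ, Fintype.card_fin, nsmul_eq_mul]
  push_cast; ring

/-- Local bound for the cube in terms of the energy. -/
theorem exists_lintegral_cutoff_cube_le {φ : SpaceTime → ℝ} (hφ : IsTest φ) (h1 : ∀ z, ‖φ z‖ ≤ 1)
    (N E : ℝ≥0) : ∃ B : ℝ≥0, ∀ (T : ℝ) (w : SpaceTime → R4) (Dw : Fin 4 → SpaceTime → R4),
      HasWeakGrad T w Dw → normLinfL2 (slab T) w ≤ N →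
      ∫⁻ z in slab T, (‖w z‖ₑ ^ 2 + ∑ j, ‖Dw j z‖ₑ ^ 2) ≤ E →
      ∫⁻ z in slab T, ‖φ z • w z‖ₑ ^ 3 ≤ B := by
  obtain ⟨C, hC⟩ := exists_lintegral_cube_le
  obtain ⟨c, -, hc⟩ := hφ.exists_bound
  refine ⟨C * N * (2 * E + 8 * c ^ 2 * E), fun T w Dw h hN hE => ?_⟩
  refine (hC T _ _ h φ hφ h1 univ isOpen_univ (by simp)).trans ?_
  rw [univ_inter]
  push_cast
  gcongr
  have hle : ∀ z, ∑ j, ‖φ z • Dw j z + pd j φ z • w z‖ₑ ^ 2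
      ≤ 2 * (∑ j, ‖Dw j z‖ₑ ^ 2) + 8 * c ^ 2 * ‖w z‖ₑ ^ 2 := fun z => by
    refine (sum_enorm_cutoff_sq_le hc _ _ z).trans ?_
    gcongr
    · refine mul_le_of_le_one_left zero_le (pow_le_one' ?_ 2)
      rw [← ofReal_norm]; exact ENNReal.ofReal_le_one.2 (h1 z)
    · exact indicator_le_self _ _ z
  refine (lintegral_mono hle).trans ?_
  rw [lintegral_add_right', lintegral_const_mul' _ _ (by simp),
    lintegral_const_mul' _ _ (by finiteness)]
  · gcongr
    · exact (lintegral_mono fun _ => le_add_self).trans hE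
    · exact (lintegral_mono fun _ => le_self_add).trans hE
  · exact (h.aesm.enorm.pow_const 2).const_mul _

namespace IsVanishing

variable {T : ℝ} {w : ℕ → SpaceTime → R4} {Dw : ℕ → Fin 4 → SpaceTime → R4} {N E : ℝ≥0}
  (H : IsVanishing T w Dw N E)
include H

theorem lintegral_sq_le (k : ℕ) : ∫⁻ z in slab T, ‖w k z‖ₑ ^ 2 ≤ E :=
  (lintegral_mono fun _ => le_self_add).trans (H.energy_le k)

theorem lintegral_sum_grad_le (k : ℕ) : ∫⁻ z in slab T, ∑ j, ‖Dw k j z‖ₑ ^ 2 ≤ E :=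
  (lintegral_mono fun _ => le_add_self).trans (H.energy_le k)

theorem lintegral_grad_le (k : ℕ) (j : Fin 4) : ∫⁻ z in slab T, ‖Dw k j z‖ₑ ^ 2 ≤ E :=
  (lintegral_mono fun z => Finset.single_le_sum (f := fun j => ‖Dw k j z‖ₑ ^ 2)
    (fun _ _ => zero_le) (Finset.mem_univ j)).trans (H.lintegral_sum_grad_le k)

theorem memLp (k : ℕ) : MemLp (w k) 2 (volume.restrict (slab T)) :=
  memLp_two_of_lintegral_le (H.hasWeakGrad k).aesm (H.lintegral_sq_le k)

theorem memLp_grad (k : ℕ) (j : Fin 4) : MemLp (Dw k j) 2 (volume.restrict (slab T)) :=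
  memLp_two_of_lintegral_le ((H.hasWeakGrad k).aesm_grad j) (H.lintegral_grad_le k j)

/-- Local bound for the cubes, uniform along the sequence. -/
theorem exists_lintegral_cube_le {φ : SpaceTime → ℝ} (hφ : IsTest φ) (h1 : ∀ z, ‖φ z‖ ≤ 1) :
    ∃ B : ℝ≥0, ∀ k, ∫⁻ z in slab T, ‖φ z • w k z‖ₑ ^ 3 ≤ B := by
  obtain ⟨B, hB⟩ := exists_lintegral_cutoff_cube_le hφ h1 N E
  exact ⟨B, fun k => hB T _ _ (H.hasWeakGrad k) (H.normLinfL2_le k) (H.energy_le k)⟩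

/-- The sequence vanishes in `L²_loc(D)`. -/
theorem tendsto_lintegral_sq {φ : SpaceTime → ℝ} (hφ : IsTest φ) (h1 : ∀ z, ‖φ z‖ ≤ 1)
    {K : Set SpaceTime} (hK : IsCompact K) (hφK : ∀ z ∈ K, φ z = 1) :
    Tendsto (fun k => ∫⁻ z in K ∩ slab T, ‖w k z‖ₑ ^ 2) atTop (𝓝 0) := by
  obtain ⟨B, hB⟩ := H.exists_lintegral_cube_le hφ h1
  have hKm : MeasurableSet (K ∩ slab T) := hK.measurableSet.inter (measurableSet_slab T)
  -- Interpolation `(∫ |w|²)² ≤ ∫ |w| · ∫ |w|³` on `K ∩ D`: the first factor vanishes and the second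
  -- stays bounded.
  have hle : ∀ k, ∫⁻ z in K ∩ slab T, ‖w k z‖ₑ ^ 2
      ≤ ((∫⁻ z in K ∩ slab T, ‖w k z‖ₑ) * B) ^ (1 / 2 : ℝ) := fun k => by
    have hm : AEMeasurable (fun z => ‖w k z‖ₑ) (volume.restrict (K ∩ slab T)) :=
      ((H.hasWeakGrad k).aesm.mono_measure (Measure.restrict_mono inter_subset_right le_rfl)).enorm
    have h := sq_lintegral_mul_le_weighted hm hm
    have h3 : ∫⁻ z in K ∩ slab T, ‖w k z‖ₑ * ‖w k z‖ₑ ^ 2 ≤ B := by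
      refine le_trans ?_ (hB k)
      refine le_trans (le_of_eq ?_) (lintegral_mono_set (inter_subset_right (s := K)))
      refine setLIntegral_congr_fun hKm fun z hz => ?_
      simp only [hφK z hz.1, one_smul]; ring
    have h4 : (∫⁻ z in K ∩ slab T, ‖w k z‖ₑ ^ 2) ^ 2 ≤ (∫⁻ z in K ∩ slab T, ‖w k z‖ₑ) * B := by
      simp only [pow_two (‖w k _‖ₑ)]
      exact h.trans (mul_le_mul_right h3 _)
    calc ∫⁻ z in K ∩ slab T, ‖w k z‖ₑ ^ 2
        = ((∫⁻ z in K ∩ slab T, ‖w k z‖ₑ ^ 2) ^ 2) ^ (1 / 2 : ℝ) := by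
          rw [← ENNReal.rpow_natCast, ← ENNReal.rpow_mul]; norm_num
      _ ≤ _ := ENNReal.rpow_le_rpow h4 (by norm_num)
  have hlim : Tendsto (fun k => ((∫⁻ z in K ∩ slab T, ‖w k z‖ₑ) * B) ^ (1 / 2 : ℝ)) atTop
      (𝓝 0) := by
    have h0 := ENNReal.Tendsto.mul_const (b := (B : ℝ≥0∞)) (H.tendsto (K ∩ slab T)
      (hK.inter_right (isClosed_slab T)) inter_subset_right) (Or.inr ENNReal.coe_ne_top)
    rw [zero_mul] at h0
    have := (ENNReal.continuous_rpow_const (y := (1 / 2 : ℝ))).tendsto 0 |>.comp h0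
    simpa [Function.comp_def] using this
  exact tendsto_of_tendsto_of_tendsto_of_le_of_le tendsto_const_nhds hlim (fun _ => zero_le) hle

/-- The gradients converge weakly to zero against smooth functions. -/
theorem tendsto_integral_test_smul_grad (j : Fin 4) {ψ : SpaceTime → ℝ} (hψ : IsTest ψ) :
    Tendsto (fun k => ∫ z in slab T, ψ z • Dw k j z) atTop (𝓝 0) := by
  obtain ⟨c, -, hc⟩ := hψ.exists_bound
  set K := tsupport ψ
  -- After integration by parts only `w k` on the support of `ψ` remains, where `L¹` convergence
  -- applies.
  have hle : ∀ k, ‖∫ z in slab T, ψ z • Dw k j z‖ₑ ≤ c * ∫⁻ z in K ∩ slab T, ‖w k z‖ₑ := by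
    intro k
    rw [(H.hasWeakGrad k).integral_smul j hψ ((H.memLp k).locallyIntegrable (by norm_num))
      ((H.memLp_grad k j).locallyIntegrable (by norm_num)), enorm_neg]
    refine (enorm_integral_le_lintegral_enorm _).trans ?_
    rw [← lintegral_const_mul' _ _ (by simp), ← Measure.restrict_restrict
      (isClosed_tsupport ψ).measurableSet, ← lintegral_indicator (isClosed_tsupport ψ).measurableSet]
    refine lintegral_mono fun z => ?_
    by_cases hz : z ∈ tsupport ψ
    · rw [indicator_of_mem hz, enorm_smul]
      gcongr
      rw [← ofReal_norm, ← ENNReal.ofReal_coe_nnreal]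
      exact ENNReal.ofReal_le_ofReal (hc j z)
    · simp [pd_of_notMem_tsupport j hz]
  rw [tendsto_zero_iff_enorm_tendsto_zero]
  have h0 := ENNReal.Tendsto.const_mul (a := (c : ℝ≥0∞)) (H.tendsto (K ∩ slab T)
    (hψ.hasCompactSupport.isCompact.inter_right (isClosed_slab T)) inter_subset_right)
    (Or.inr ENNReal.coe_ne_top)
  rw [mul_zero] at h0
  exact tendsto_of_tendsto_of_tendsto_of_le_of_le tendsto_const_nhds h0 (fun _ => zero_le) hle

/-- The gradients converge weakly to zero in `L²`. -/
theorem tendsto_integral_smul_grad (j : Fin 4) {h : SpaceTime → ℝ}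
    (hh : MemLp h 2 (volume.restrict (slab T))) :
    Tendsto (fun k => ∫ z in slab T, h z • Dw k j z) atTop (𝓝 0) := by
  rw [tendsto_zero_iff_enorm_tendsto_zero, ENNReal.tendsto_nhds_zero]
  intro ε hε
  -- `√E` bounds the `L²` norms of the gradients uniformly, so approximating `h` within `δ` costs at
  -- most `ε / 2` for every `k`.
  obtain ⟨δ, hδ, hδε⟩ : ∃ δ : ℝ, 0 < δ ∧
      ENNReal.ofReal δ * (E : ℝ≥0∞) ^ (1 / 2 : ℝ) ≤ ε / 2 := by
    have : Tendsto (fun δ : ℝ => ENNReal.ofReal δ * (E : ℝ≥0∞) ^ (1 / 2 : ℝ)) (𝓝[>] 0) (𝓝 0) := by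
      have := ENNReal.Tendsto.mul_const (b := (E : ℝ≥0∞) ^ (1 / 2 : ℝ))
        ((ENNReal.continuous_ofReal.tendsto 0).mono_left (nhdsWithin_le_nhds (s := Ioi 0)))
        (Or.inr (by finiteness))
      simpa using this
    have h2 := (ENNReal.tendsto_nhds_zero.1 this) (ε / 2) (ENNReal.half_pos hε.ne')
    obtain ⟨δ, h3, h4⟩ := (h2.and self_mem_nhdsWithin).exists
    exact ⟨δ, h4, h3⟩
  obtain ⟨ψ, hψc, hψs, hψ⟩ := hh.exist_eLpNorm_sub_le (by norm_num) (by norm_num) hδ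
  have hψt : IsTest ψ := ⟨hψs, hψc⟩
  have ht := (ENNReal.tendsto_nhds_zero.1 (tendsto_zero_iff_enorm_tendsto_zero.1
    (H.tendsto_integral_test_smul_grad j hψt))) (ε / 2) (ENNReal.half_pos hε.ne')
  have hψL : MemLp ψ 2 (volume.restrict (slab T)) :=
    hψt.continuous.memLp_of_hasCompactSupport hψc
  filter_upwards [ht] with k hk
  have hsplit : ∫ z in slab T, h z • Dw k j z
      = (∫ z in slab T, (h - ψ) z • Dw k j z) + ∫ z in slab T, ψ z • Dw k j z := by
    rw [← integral_add]
    · simp only [Pi.sub_apply, sub_smul, sub_add_cancel]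
    · exact memLp_one_iff_integrable.1 ((H.memLp_grad k j).smul (hh.sub hψL))
    · exact memLp_one_iff_integrable.1 ((H.memLp_grad k j).smul hψL)
  rw [hsplit, ← ENNReal.add_halves ε]
  refine (enorm_add_le _ _).trans (add_le_add ?_ hk)
  refine (enorm_integral_le_lintegral_enorm _).trans ?_
  rw [← eLpNorm_one_eq_lintegral_enorm]
  have hg : eLpNorm (Dw k j) 2 (volume.restrict (slab T)) ≤ (E : ℝ≥0∞) ^ (1 / 2 : ℝ) := by
    have := H.lintegral_grad_le k j
    rw [← sq_eLpNorm_two] at this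
    calc _ = (eLpNorm (Dw k j) 2 (volume.restrict (slab T)) ^ 2) ^ (1 / 2 : ℝ) := by
          rw [← ENNReal.rpow_natCast, ← ENNReal.rpow_mul]; norm_num
      _ ≤ _ := ENNReal.rpow_le_rpow this (by norm_num)
  calc _ ≤ eLpNorm (h - ψ) 2 (volume.restrict (slab T))
        * eLpNorm (Dw k j) 2 (volume.restrict (slab T)) :=
        eLpNorm_smul_le_mul_eLpNorm (H.memLp_grad k j).1 (hh.sub hψL).1
    _ ≤ ENNReal.ofReal δ * (E : ℝ≥0∞) ^ (1 / 2 : ℝ) := by gcongr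
    _ ≤ ε / 2 := hδε

end IsVanishing

/-! ### Comparison of measures by test functions -/

theorem exists_isTest_bump {K O : Set SpaceTime} (hK : IsCompact K) (hO : IsOpen O) (hKO : K ⊆ O) :
    ∃ φ : SpaceTime → ℝ, IsTest φ ∧ (∀ z, 0 ≤ φ z) ∧ (∀ z, φ z ≤ 1) ∧ (∀ z ∈ K, φ z = 1) ∧
      ∀ z, z ∉ O → φ z = 0 := by
  obtain ⟨L, hL, hKL, hLO⟩ := exists_compact_between hK hO hKO
  obtain ⟨f, hf1, hf0, hf⟩ := exists_contMDiffMap_one_nhds_of_subset_interior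
    (n := (⊤ : ℕ∞)) (modelWithCornersSelf ℝ SpaceTime) hK.isClosed hKL
  refine ⟨f, ⟨f.contMDiff.contDiff, HasCompactSupport.intro hL fun z hz => hf0 z hz⟩,
    fun z => (hf z).1, fun z => (hf z).2, fun z hz => ?_, fun z hz => hf0 z fun h => hz (hLO h)⟩
  exact (hf1.filter_mono (nhds_le_nhdsSet hz)).self_of_nhds

theorem measure_le_lintegral_test {m : Measure SpaceTime} {K : Set SpaceTime} (hK : IsCompact K)
    {φ : SpaceTime → ℝ} (h1 : ∀ z ∈ K, φ z = 1) (p : ℕ) :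
    m K ≤ ∫⁻ z, ENNReal.ofReal (φ z ^ p) ∂m := by
  rw [← lintegral_indicator_one hK.measurableSet]
  refine lintegral_mono fun z => ?_
  by_cases hz : z ∈ K <;> simp [hz, h1]

theorem lintegral_test_le_measure {m : Measure SpaceTime} {O : Set SpaceTime} (hO : IsOpen O)
    {φ : SpaceTime → ℝ} (h0 : ∀ z, 0 ≤ φ z) (h1 : ∀ z, φ z ≤ 1) (hs : ∀ z, z ∉ O → φ z = 0)
    {p : ℕ} (hp : p ≠ 0) : ∫⁻ z, ENNReal.ofReal (φ z ^ p) ∂m ≤ m O := by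
  rw [← lintegral_indicator_one hO.measurableSet]
  refine lintegral_mono fun z => ?_
  by_cases hz : z ∈ O
  · rw [indicator_of_mem hz]
    exact ENNReal.ofReal_le_one.2 (pow_le_one₀ (h0 z) (h1 z))
  · simp [hs z hz, hp]

/-- A comparison of two measures on test functions gives the comparison on open sets. -/
theorem measure_isOpen_le_of_test {a b : Measure SpaceTime} [IsFiniteMeasure a] {c : ℝ≥0∞}
    {O : Set SpaceTime} (hO : IsOpen O) (p : ℕ) {q : ℕ} (hq : q ≠ 0)
    (h : ∀ φ : SpaceTime → ℝ, IsTest φ → (∀ z, 0 ≤ φ z) → (∀ z, φ z ≤ 1) →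
      (∀ z, z ∉ O → φ z = 0) →
      ∫⁻ z, ENNReal.ofReal (φ z ^ p) ∂a ≤ c * ∫⁻ z, ENNReal.ofReal (φ z ^ q) ∂b) :
    a O ≤ c * b O := by
  -- A cut-off equal to `1` on `K` and vanishing off `O` has all its positive powers between the two
  -- indicators, so the exponents `p` and `q` need not agree.
  rw [hO.measure_eq_iSup_isCompact a]
  refine iSup₂_le fun K hKO => iSup_le fun hK => ?_
  obtain ⟨φ, hφ, h0, h1, hK1, hs⟩ := exists_isTest_bump hK hO hKO
  refine (measure_le_lintegral_test hK hK1 p).trans ((h φ hφ h0 h1 hs).trans ?_)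
  gcongr
  exact lintegral_test_le_measure hO h0 h1 hs hq

/-- A comparison of two finite measures on open sets extends to all sets. -/
theorem measure_le_smul_of_isOpen {X : Type*} [TopologicalSpace X] [MeasurableSpace X]
    {a b : Measure X} [b.OuterRegular] {c : ℝ≥0∞} (hc : c ≠ ∞)
    (h : ∀ O, IsOpen O → a O ≤ c * b O) : a ≤ c • b := by
  refine Measure.le_intro fun s hs _ => ?_
  have : (c • b).OuterRegular := Measure.OuterRegular.smul b hc
  rw [s.measure_eq_iInf_isOpen (c • b)]
  refine le_iInf₂ fun U hsU => le_iInf fun hU => ?_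
  exact (measure_mono hsU).trans (h U hU)

/-- A bound for the density from a bound on the open subsets of an open set. -/
theorem ae_rnDeriv_le_of_isOpen {a b : Measure SpaceTime} [IsFiniteMeasure a] [IsFiniteMeasure b]
    (hab : a ≪ b) {c : ℝ≥0∞} (hc : c ≠ ∞) {O : Set SpaceTime} (hO : IsOpen O)
    (h : ∀ U, IsOpen U → U ⊆ O → a U ≤ c * b U) : ∀ᵐ z ∂b, z ∈ O → a.rnDeriv b z ≤ c := by
  have hr : a.restrict O ≤ c • b.restrict O := by
    refine measure_le_smul_of_isOpen hc fun U hU => ?_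
    rw [Measure.restrict_apply hU.measurableSet, Measure.restrict_apply hU.measurableSet]
    exact h _ (hU.inter hO) inter_subset_right
  have := Measure.haveLebesgueDecomposition_of_sigmaFinite a b
  rw [← ae_restrict_iff' hO.measurableSet]
  refine ae_le_of_forall_setLIntegral_le_of_sigmaFinite (Measure.measurable_rnDeriv a b)
    fun s hs _ => ?_
  rw [Measure.restrict_restrict hs, Measure.setLIntegral_rnDeriv hab, setLIntegral_const]
  have := hr s
  rw [Measure.restrict_apply hs, Measure.smul_apply, Measure.restrict_apply hs] at this
  exact this

theorem IsTest.ofReal_integral {φ : SpaceTime → ℝ} (hφ : IsTest φ) (h0 : ∀ z, 0 ≤ φ z)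
    (m : Measure SpaceTime) [IsFiniteMeasure m] :
    ENNReal.ofReal (∫ z, φ z ∂m) = ∫⁻ z, ENNReal.ofReal (φ z) ∂m :=
  ofReal_integral_eq_lintegral_ofReal
    (hφ.continuous.integrable_of_hasCompactSupport hφ.hasCompactSupport)
    (Eventually.of_forall h0)

theorem IsTest.pow {φ : SpaceTime → ℝ} (hφ : IsTest φ) {p : ℕ} (hp : p ≠ 0) :
    IsTest fun z => φ z ^ p := by
  refine ⟨hφ.contDiff.pow p, ?_⟩
  exact hφ.hasCompactSupport.comp_left (g := fun x : ℝ => x ^ p) (by simp [hp])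

/-! ### The gradient and cube measures -/

theorem integral_gradMeasure {T : ℝ} {Du : Fin 4 → SpaceTime → R4}
    (h : ∀ j, AEStronglyMeasurable (Du j) (volume.restrict (slab T))) (φ : SpaceTime → ℝ) :
    ∫ z, φ z ∂(gradMeasure T Du) = ∫ z in slab T, φ z * gradSq Du z := by
  rw [gradMeasure, integral_withDensity_eq_integral_toReal_smul₀]
  · refine integral_congr_ae (Eventually.of_forall fun z => ?_)
    have : 0 ≤ gradSq Du z := Finset.sum_nonneg fun _ _ => by positivity
    simp only [ENNReal.toReal_ofReal this, smul_eq_mul]; ring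
  · exact (Finset.aemeasurable_fun_sum _ fun j _ =>
      (h j).norm.aemeasurable.pow_const 2).ennreal_ofReal
  · exact Eventually.of_forall fun _ => ENNReal.ofReal_lt_top

theorem integral_cubeMeasure {T : ℝ} {u : SpaceTime → R4}
    (h : AEStronglyMeasurable u (volume.restrict (slab T))) (φ : SpaceTime → ℝ) :
    ∫ z, φ z ∂(cubeMeasure T u) = ∫ z in slab T, φ z * ‖u z‖ ^ 3 := by
  rw [cubeMeasure, integral_withDensity_eq_integral_toReal_smul₀]
  · refine integral_congr_ae (Eventually.of_forall fun z => ?_)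
    have : 0 ≤ ‖u z‖ ^ 3 := by positivity
    simp only [ENNReal.toReal_ofReal this, smul_eq_mul]; ring
  · exact (h.norm.aemeasurable.pow_const 3).ennreal_ofReal
  · exact Eventually.of_forall fun _ => ENNReal.ofReal_lt_top

theorem integrable_gradSq {T : ℝ} {Du : Fin 4 → SpaceTime → R4}
    (h : ∀ j, MemLp (Du j) 2 (volume.restrict (slab T))) :
    Integrable (gradSq Du) (volume.restrict (slab T)) :=
  integrable_finsetSum _ fun j _ => (h j).integrable_norm_pow (p := 2) two_ne_zero

theorem IsTest.integrable_mul {φ f : SpaceTime → ℝ} (hφ : IsTest φ) {m : Measure SpaceTime}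
    (hf : Integrable f m) : Integrable (fun z => φ z * f z) m := by
  obtain ⟨c, hc, -⟩ := hφ.exists_bound
  exact hf.bdd_mul hφ.continuous.aestronglyMeasurable (Eventually.of_forall hc)

theorem isFiniteMeasure_gradMeasure {T : ℝ} {Du : Fin 4 → SpaceTime → R4}
    (h : ∀ j, MemLp (Du j) 2 (volume.restrict (slab T))) : IsFiniteMeasure (gradMeasure T Du) :=
  isFiniteMeasure_withDensity_ofReal (integrable_gradSq h).2

theorem IsEnergyClass.memLp_grad {T : ℝ} {u : SpaceTime → R4} {Du : Fin 4 → SpaceTime → R4}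
    (h : IsEnergyClass T u Du) (j : Fin 4) : MemLp (Du j) 2 (volume.restrict (slab T)) := by
  have h1 : normL2H1 T u Du ^ 2 ≠ ∞ := ENNReal.pow_ne_top h.l2H1_lt_top.ne
  refine memLp_two_of_lintegral_le (E := (normL2H1 T u Du ^ 2).toNNReal) (h.aesm_grad j) ?_
  rw [ENNReal.coe_toNNReal h1, ← lintegral_energy_eq]
  refine lintegral_mono fun z => le_trans ?_ le_add_self
  exact Finset.single_le_sum (f := fun j => ‖Du j z‖ₑ ^ 2) (fun _ _ => zero_le) (Finset.mem_univ j)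

/-- Functions with finite energy have locally integrable cubes. -/
theorem HasWeakGrad.integrable_test_mul_cube {T : ℝ} {u : SpaceTime → R4}
    {Du : Fin 4 → SpaceTime → R4} (h : HasWeakGrad T u Du) {N E : ℝ≥0}
    (hN : normLinfL2 (slab T) u ≤ N)
    (hE : ∫⁻ z in slab T, (‖u z‖ₑ ^ 2 + ∑ j, ‖Du j z‖ₑ ^ 2) ≤ E)
    {φ : SpaceTime → ℝ} (hφ : IsTest φ) :
    Integrable (fun z => φ z * ‖u z‖ ^ 3) (volume.restrict (slab T)) := by
  -- Since `χ = 1` on the support of `φ`, one has `φ |u|³ = φ |χ u|³`, and the cube of `χ u` is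
  -- integrable.
  obtain ⟨χ, hχ, h0, h1, hK, -⟩ := exists_isTest_bump hφ.hasCompactSupport.isCompact isOpen_univ
    (subset_univ _)
  obtain ⟨B, hB⟩ := exists_lintegral_cutoff_cube_le hχ
    (fun z => by rw [Real.norm_of_nonneg (h0 z)]; exact h1 z) N E
  have hi : Integrable (fun z => ‖χ z • u z‖ ^ 3) (volume.restrict (slab T)) := by
    refine ⟨((hχ.continuous.aestronglyMeasurable.smul h.aesm).norm.pow 3), ?_⟩
    refine lt_of_le_of_lt (lintegral_mono fun z => ?_) ((hB T u Du h hN hE).trans_lt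
      ENNReal.coe_lt_top)
    simp [enorm_pow]
  refine (hφ.integrable_mul hi).congr (Eventually.of_forall fun z => ?_)
  by_cases hz : z ∈ tsupport φ
  · simp [hK z hz]
  · simp [image_eq_zero_of_notMem_tsupport hz]

theorem IsEnergyClass.integrable_test_mul_cube {T : ℝ} {u : SpaceTime → R4}
    {Du : Fin 4 → SpaceTime → R4} (h : IsEnergyClass T u Du) {φ : SpaceTime → ℝ} (hφ : IsTest φ) :
    Integrable (fun z => φ z * ‖u z‖ ^ 3) (volume.restrict (slab T)) := by
  have hE : normL2H1 T u Du ^ 2 ≠ ∞ := ENNReal.pow_ne_top h.l2H1_lt_top.ne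
  exact h.hasWeakGrad.integrable_test_mul_cube (N := (normLinfL2 (slab T) u).toNNReal)
    (E := (normL2H1 T u Du ^ 2).toNNReal) (by rw [ENNReal.coe_toNNReal h.linfL2_lt_top.ne])
    (by rw [ENNReal.coe_toNNReal hE, lintegral_energy_eq]) hφ

/-! ### Passing to the limit in the gradient and cube measures -/

theorem exists_isVanishing_sub {T : ℝ} {u : ℕ → SpaceTime → R4} {Du : ℕ → Fin 4 → SpaceTime → R4}
    {v : SpaceTime → R4} {Dv : Fin 4 → SpaceTime → R4} (hu : ∀ k, IsEnergyClass T (u k) (Du k))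
    {M : ℝ≥0} (hM : ∀ k, normLinfL2 (slab T) (u k) ≤ M ∧ normL2H1 T (u k) (Du k) ≤ M)
    (hv : IsEnergyClass T v Dv) (hL : TendstoL1loc T u v) :
    ∃ N E : ℝ≥0, IsVanishing T (fun k => u k - v) (fun k => Du k - Dv) N E := by
  refine ⟨M + (normLinfL2 (slab T) v).toNNReal,
    2 * M ^ 2 + 2 * (normL2H1 T v Dv).toNNReal ^ 2,
    fun k => (hu k).hasWeakGrad.sub hv.hasWeakGrad, fun k => ?_, fun k => ?_, hL⟩
  · refine (normLinfL2_sub_le (hu k).hasWeakGrad hv.hasWeakGrad).trans ?_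
    push_cast
    rw [ENNReal.coe_toNNReal hv.linfL2_lt_top.ne]
    gcongr
    exact (hM k).1
  · refine (lintegral_energy_sub_le (D₂ := Dv) (hu k).hasWeakGrad).trans ?_
    push_cast
    rw [ENNReal.coe_toNNReal hv.l2H1_lt_top.ne]
    gcongr
    exact (hM k).2

/-- The cross term pairs `b` with `a - b` rather than with `a`: a fixed function against a weakly
null sequence. -/
theorem norm_sub_sq_eq_sum (a b : R4) :
    ‖a - b‖ ^ 2 = ‖a‖ ^ 2 - ‖b‖ ^ 2 - 2 * ∑ i, b i * (a - b) i := by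
  simp only [EuclideanSpace.real_norm_sq_eq, Fin.sum_univ_four, PiLp.sub_apply]
  ring

/-- The difference of the two sides is `3 (a + b) (a - b)²`. -/
theorem add_cube_le_four_mul {a b : ℝ} (ha : 0 ≤ a) (hb : 0 ≤ b) :
    (a + b) ^ 3 ≤ 4 * a ^ 3 + 4 * b ^ 3 := by
  nlinarith [mul_nonneg (add_nonneg ha hb) (sq_nonneg (a - b))]

section Limits

variable {T : ℝ} {u : ℕ → SpaceTime → R4} {Du : ℕ → Fin 4 → SpaceTime → R4}
  {v : SpaceTime → R4} {Dv : Fin 4 → SpaceTime → R4} {N E : ℝ≥0} {μ ν : Measure SpaceTime}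

/-- Each component of `φ ∂ⱼv` lies in `L²`, so the cross terms tend to zero by weak convergence of
the gradients. The limit is the gradient defect tested against `φ`. -/
theorem tendsto_integral_gradSq_sub
    (H : IsVanishing T (fun k => u k - v) (fun k => Du k - Dv) N E)
    (hu : ∀ k, IsEnergyClass T (u k) (Du k)) (hv : IsEnergyClass T v Dv)
    (hμ : TendstoWeakly (fun k => gradMeasure T (Du k)) μ) {φ : SpaceTime → ℝ} (hφ : IsTest φ) :
    Tendsto (fun k => ∫ z in slab T, φ z * gradSq (Du k - Dv) z) atTop
      (𝓝 (∫ z, φ z ∂μ - ∫ z in slab T, φ z * gradSq Dv z)) := by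
  have hc : ∀ j i, MemLp (fun z => φ z * Dv j z i) 2 (volume.restrict (slab T)) := fun j i => by
    have h1 : MemLp (fun z => Dv j z i) 2 (volume.restrict (slab T)) :=
      (EuclideanSpace.proj i : R4 →L[ℝ] ℝ).comp_memLp' (hv.memLp_grad j)
    exact h1.smul (hφ.continuous.memLp_top_of_hasCompactSupport hφ.hasCompactSupport
      (volume.restrict (slab T)))
  have hw : ∀ k j i, MemLp (fun z => (Du k - Dv) j z i) 2 (volume.restrict (slab T)) :=
    fun k j i => (EuclideanSpace.proj i : R4 →L[ℝ] ℝ).comp_memLp' (H.memLp_grad k j)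
  have hprod : ∀ k j i, Integrable (fun z => (φ z * Dv j z i) * (Du k - Dv) j z i)
      (volume.restrict (slab T)) := fun k j i => (hc j i).integrable_mul (hw k j i)
  have hcross : ∀ j i, Tendsto (fun k => ∫ z in slab T, (φ z * Dv j z i) * (Du k - Dv) j z i)
      atTop (𝓝 0) := fun j i => by
    have h1 := H.tendsto_integral_smul_grad j (hc j i)
    have h2 := ((EuclideanSpace.proj i : R4 →L[ℝ] ℝ).continuous.tendsto 0).comp h1
    rw [map_zero] at h2
    refine h2.congr fun k => ?_
    have h3 : Integrable (fun z => (φ z * Dv j z i) • (Du k - Dv) j z)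
        (volume.restrict (slab T)) :=
      memLp_one_iff_integrable.1 ((H.memLp_grad k j).smul (hc j i))
    exact (ContinuousLinearMap.integral_comp_comm (EuclideanSpace.proj i : R4 →L[ℝ] ℝ) h3).symm
  have hsum : Tendsto (fun k => ∑ j, ∑ i, ∫ z in slab T, (φ z * Dv j z i) * (Du k - Dv) j z i)
      atTop (𝓝 0) := by
    have := tendsto_finsetSum (Finset.univ : Finset (Fin 4)) fun j _ =>
      tendsto_finsetSum (Finset.univ : Finset (Fin 4)) fun i _ => hcross j i
    simpa using this
  have hlim := ((hμ φ hφ.continuous hφ.hasCompactSupport).sub_const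
    (∫ z in slab T, φ z * gradSq Dv z)).sub (hsum.const_mul 2)
  rw [mul_zero, sub_zero] at hlim
  refine hlim.congr fun k => ?_
  have i1 := hφ.integrable_mul (integrable_gradSq (hu k).memLp_grad)
  have i2 := hφ.integrable_mul (integrable_gradSq hv.memLp_grad)
  have i3 : Integrable (fun z => ∑ j, ∑ i, (φ z * Dv j z i) * (Du k - Dv) j z i)
      (volume.restrict (slab T)) :=
    integrable_finsetSum _ fun j _ => integrable_finsetSum _ fun i _ => hprod k j i
  have e3 : ∫ z in slab T, ∑ j, ∑ i, (φ z * Dv j z i) * (Du k - Dv) j z i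
      = ∑ j, ∑ i, ∫ z in slab T, (φ z * Dv j z i) * (Du k - Dv) j z i := by
    rw [integral_finsetSum _ fun j _ => integrable_finsetSum _ fun i _ => hprod k j i]
    exact Finset.sum_congr rfl fun j _ => integral_finsetSum _ fun i _ => hprod k j i
  have i12 : Integrable (fun z => φ z * gradSq (Du k) z - φ z * gradSq Dv z)
      (volume.restrict (slab T)) := i1.sub i2
  rw [integral_gradMeasure (hu k).aesm_grad, ← e3, ← integral_const_mul, ← integral_sub i1 i2,
    ← integral_sub i12 (i3.const_mul 2)]
  refine integral_congr_ae (Eventually.of_forall fun z => ?_)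
  have : ∀ j, ‖(Du k - Dv) j z‖ ^ 2 = ‖Du k j z‖ ^ 2 - ‖Dv j z‖ ^ 2
      - 2 * ∑ i, Dv j z i * (Du k - Dv) j z i := fun j => norm_sub_sq_eq_sum _ _
  have hg : gradSq (Du k - Dv) z = gradSq (Du k) z - gradSq Dv z
      - 2 * ∑ j, ∑ i, Dv j z i * (Du k - Dv) j z i := by
    simp only [gradSq, this, Finset.sum_sub_distrib, Finset.mul_sum]
  simp only [hg, mul_assoc, ← Finset.mul_sum]
  ring

/-- `L¹` convergence on `K ∩ D` gives convergence in measure. The index map `ms` lets this refine a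
subsequence already chosen for its small norms. -/
theorem IsVanishing.exists_subseq_ae_tendsto {w : ℕ → SpaceTime → R4}
    {Dw : ℕ → Fin 4 → SpaceTime → R4} (H : IsVanishing T w Dw N E) {K : Set SpaceTime}
    (hK : IsCompact K) {ms : ℕ → ℕ} (hms : Tendsto ms atTop atTop) :
    ∃ ns : ℕ → ℕ, StrictMono ns ∧ ∀ᵐ z ∂(volume.restrict (slab T)), z ∈ K →
      Tendsto (fun i => w (ms (ns i)) z) atTop (𝓝 0) := by
  have hin : TendstoInMeasure (volume.restrict (K ∩ slab T)) (fun k => w (ms k)) atTop 0 := by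
    refine tendstoInMeasure_of_tendsto_eLpNorm one_ne_zero (fun k => ?_)
      aestronglyMeasurable_zero ?_
    · exact (H.hasWeakGrad _).aesm.mono_measure (Measure.restrict_mono inter_subset_right le_rfl)
    · simp only [sub_zero, eLpNorm_one_eq_lintegral_enorm]
      exact (H.tendsto _ (hK.inter_right (isClosed_slab T)) inter_subset_right).comp hms
  obtain ⟨ns, hns, h⟩ := hin.exists_seq_tendsto_ae
  refine ⟨ns, hns, ?_⟩
  rw [← Measure.restrict_restrict hK.measurableSet, ae_restrict_iff' hK.measurableSet] at h
  exact h

theorem lintegral_cubeMeasure {v : SpaceTime → R4}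
    (hv : AEStronglyMeasurable v (volume.restrict (slab T))) {φ : SpaceTime → ℝ}
    (hφ : IsTest φ) (h0 : ∀ z, 0 ≤ φ z) :
    ∫⁻ z, ENNReal.ofReal (φ z) ∂(cubeMeasure T v)
      = ∫⁻ z in slab T, ENNReal.ofReal (φ z * ‖v z‖ ^ 3) := by
  rw [cubeMeasure, lintegral_withDensity_eq_lintegral_mul₀
    (hv.norm.aemeasurable.pow_const 3).ennreal_ofReal
    hφ.continuous.measurable.ennreal_ofReal.aemeasurable]
  refine lintegral_congr fun z => ?_
  rw [Pi.mul_apply, mul_comm, ENNReal.ofReal_mul (h0 z)]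

/-- Fatou's lemma for the cube measures. -/
theorem lintegral_cubeMeasure_le [IsFiniteMeasure ν]
    (H : IsVanishing T (fun k => u k - v) (fun k => Du k - Dv) N E)
    (hu : ∀ k, IsEnergyClass T (u k) (Du k)) (hv : IsEnergyClass T v Dv)
    (hν : TendstoWeakly (fun k => cubeMeasure T (u k)) ν) {φ : SpaceTime → ℝ} (hφ : IsTest φ)
    (h0 : ∀ z, 0 ≤ φ z) :
    ∫⁻ z, ENNReal.ofReal (φ z) ∂(cubeMeasure T v) ≤ ∫⁻ z, ENNReal.ofReal (φ z) ∂ν := by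
  obtain ⟨ns, hns, hae⟩ := H.exists_subseq_ae_tendsto hφ.hasCompactSupport.isCompact tendsto_id
  rw [lintegral_cubeMeasure hv.aesm hφ h0, ← hφ.ofReal_integral h0]
  have hle : ∫⁻ z in slab T, ENNReal.ofReal (φ z * ‖v z‖ ^ 3)
      ≤ ∫⁻ z in slab T, liminf (fun i => ENNReal.ofReal (φ z * ‖u (ns i) z‖ ^ 3)) atTop := by
    refine lintegral_mono_ae ?_
    filter_upwards [hae] with z hz
    by_cases hzK : z ∈ tsupport φ
    · have h1 : Tendsto (fun i => u (ns i) z) atTop (𝓝 (v z)) := by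
        have := (hz hzK).add_const (v z)
        simpa using this
      have h2 : Tendsto (fun i => ENNReal.ofReal (φ z * ‖u (ns i) z‖ ^ 3)) atTop
          (𝓝 (ENNReal.ofReal (φ z * ‖v z‖ ^ 3))) :=
        (ENNReal.continuous_ofReal.tendsto _).comp ((h1.norm.pow 3).const_mul _)
      rw [h2.liminf_eq]
    · simp [image_eq_zero_of_notMem_tsupport hzK]
  refine hle.trans ((lintegral_liminf_le' fun i => ?_).trans (le_of_eq ?_))
  · exact (hφ.continuous.measurable.aemeasurable.mul
      ((hu (ns i)).aesm.norm.aemeasurable.pow_const 3)).ennreal_ofReal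
  · refine Tendsto.liminf_eq ?_
    have h1 := (ENNReal.continuous_ofReal.tendsto _).comp
      ((hν φ hφ.continuous hφ.hasCompactSupport).comp hns.tendsto_atTop)
    refine h1.congr fun i => ?_
    simp only [Function.comp_apply]
    rw [integral_cubeMeasure (hu _).aesm]
    exact ofReal_integral_eq_lintegral_ofReal ((hu _).integrable_test_mul_cube hφ)
      (Eventually.of_forall fun z => mul_nonneg (h0 z) (by positivity))

/-- An upper bound of Brezis–Lieb type for the limit of the cube measures. -/
theorem integral_le_of_subseq_cube_le
    (H : IsVanishing T (fun k => u k - v) (fun k => Du k - Dv) N E)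
    (hu : ∀ k, IsEnergyClass T (u k) (Du k)) (hv : IsEnergyClass T v Dv)
    (hν : TendstoWeakly (fun k => cubeMeasure T (u k)) ν) {ψ : SpaceTime → ℝ} (hψ : IsTest ψ)
    (h0 : ∀ z, 0 ≤ ψ z) {ms : ℕ → ℕ} (hms : Tendsto ms atTop atTop) {b : ℕ → ℝ} {b' : ℝ}
    (hb : ∀ k, ∫ z in slab T, ψ z * ‖(u (ms k) - v) z‖ ^ 3 ≤ b k) (hb' : Tendsto b atTop (𝓝 b')) :
    ∫ z, ψ z ∂ν ≤ (∫ z in slab T, ψ z * ‖v z‖ ^ 3) + 4 * b' := by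
  obtain ⟨ns, hns, hae⟩ := H.exists_subseq_ae_tendsto hψ.hasCompactSupport.isCompact hms
  -- `R` is the part of `|u|³` not covered by `|v|³ + 4 |u - v|³`. It is dominated by `3 ψ |v|³`, by
  -- convexity of the cube, and tends to zero almost everywhere, so its integral vanishes in the
  -- limit.
  set R : ℕ → SpaceTime → ℝ := fun i z =>
    ψ z * max (‖u (ms (ns i)) z‖ ^ 3 - ‖v z‖ ^ 3 - 4 * ‖(u (ms (ns i)) - v) z‖ ^ 3) 0 with hR
  have iv : Integrable (fun z => ψ z * ‖v z‖ ^ 3) (volume.restrict (slab T)) :=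
    hv.integrable_test_mul_cube hψ
  have iw : ∀ k, Integrable (fun z => ψ z * ‖(u k - v) z‖ ^ 3) (volume.restrict (slab T)) :=
    fun k => (H.hasWeakGrad k).integrable_test_mul_cube (H.normLinfL2_le k) (H.energy_le k) hψ
  have hRm : ∀ i, AEStronglyMeasurable (R i) (volume.restrict (slab T)) := fun i => by
    have h1 := (hu (ms (ns i))).aesm
    have h2 := (H.hasWeakGrad (ms (ns i))).aesm
    exact hψ.continuous.aestronglyMeasurable.mul ((((h1.norm.pow 3).sub (hv.aesm.norm.pow 3)).sub
      ((h2.norm.pow 3).const_mul 4)).sup aestronglyMeasurable_const)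
  have hRb : ∀ i z, ‖R i z‖ ≤ 3 * (ψ z * ‖v z‖ ^ 3) := fun i z => by
    rw [Real.norm_of_nonneg (mul_nonneg (h0 z) (le_max_right _ _)), mul_left_comm]
    refine mul_le_mul_of_nonneg_left (max_le ?_ (by positivity)) (h0 z)
    have h1 : ‖u (ms (ns i)) z‖ ≤ ‖v z‖ + ‖(u (ms (ns i)) - v) z‖ := by
      have := norm_add_le (v z) ((u (ms (ns i)) - v) z)
      simpa using this
    have h2 := pow_le_pow_left₀ (norm_nonneg _) h1 3
    have h3 := add_cube_le_four_mul (norm_nonneg (v z)) (norm_nonneg ((u (ms (ns i)) - v) z))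
    linarith
  have hRlim : Tendsto (fun i => ∫ z in slab T, R i z) atTop (𝓝 0) := by
    have := tendsto_integral_of_dominated_convergence (f := fun _ => (0 : ℝ))
      (fun z => 3 * (ψ z * ‖v z‖ ^ 3)) hRm (iv.const_mul 3)
      (fun i => Eventually.of_forall (hRb i)) ?_
    · simpa using this
    filter_upwards [hae] with z hz
    by_cases hzK : z ∈ tsupport ψ
    · have h1 := hz hzK
      have h2 : Tendsto (fun i => u (ms (ns i)) z) atTop (𝓝 (v z)) := by
        have := h1.add_const (v z)
        simpa using this
      have h3 := ((((h2.norm.pow 3).sub_const (‖v z‖ ^ 3)).sub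
        ((h1.norm.pow 3).const_mul 4)).max (tendsto_const_nhds (x := (0 : ℝ)))).const_mul (ψ z)
      have h4 : ψ z * max (‖v z‖ ^ 3 - ‖v z‖ ^ 3 - 4 * ‖(0 : R4)‖ ^ 3) 0 = 0 := by simp
      rw [h4] at h3
      exact h3
    · simp [hR, image_eq_zero_of_notMem_tsupport hzK]
  have hlim := (((hb'.comp hns.tendsto_atTop).const_mul 4).add hRlim).const_add
    (∫ z in slab T, ψ z * ‖v z‖ ^ 3)
  rw [add_zero] at hlim
  refine le_of_tendsto_of_tendsto' ((hν ψ hψ.continuous hψ.hasCompactSupport).comp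
    (hms.comp hns.tendsto_atTop)) hlim fun i => ?_
  simp only [Function.comp_apply]
  have iR : Integrable (R i) (volume.restrict (slab T)) :=
    (iv.const_mul 3).mono' (hRm i) (Eventually.of_forall (hRb i))
  have iwR : Integrable (fun z => 4 * (ψ z * ‖(u (ms (ns i)) - v) z‖ ^ 3) + R i z)
      (volume.restrict (slab T)) := ((iw _).const_mul 4).add iR
  rw [integral_cubeMeasure (hu _).aesm]
  calc ∫ z in slab T, ψ z * ‖u (ms (ns i)) z‖ ^ 3
      ≤ ∫ z in slab T, (ψ z * ‖v z‖ ^ 3 +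
          (4 * (ψ z * ‖(u (ms (ns i)) - v) z‖ ^ 3) + R i z)) := by
        refine integral_mono ((hu _).integrable_test_mul_cube hψ)
          (iv.add iwR) fun z => ?_
        have := mul_le_mul_of_nonneg_left (le_max_left (‖u (ms (ns i)) z‖ ^ 3 - ‖v z‖ ^ 3
          - 4 * ‖(u (ms (ns i)) - v) z‖ ^ 3) 0) (h0 z)
        simp only [hR]
        linarith
    _ = (∫ z in slab T, ψ z * ‖v z‖ ^ 3) + (4 * (∫ z in slab T,
          ψ z * ‖(u (ms (ns i)) - v) z‖ ^ 3) + ∫ z in slab T, R i z) := by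
        rw [integral_add iv iwR, integral_add ((iw _).const_mul 4) iR,
          integral_const_mul]
    _ ≤ _ := by gcongr; exact hb _

end Limits

/-! ### The estimate linking the two defect measures -/

theorem IsVanishing.tendsto_lintegral_sq_compact {T : ℝ} {w : ℕ → SpaceTime → R4}
    {Dw : ℕ → Fin 4 → SpaceTime → R4} {N E : ℝ≥0} (H : IsVanishing T w Dw N E)
    {K : Set SpaceTime} (hK : IsCompact K) :
    Tendsto (fun k => ∫⁻ z in K ∩ slab T, ‖w k z‖ₑ ^ 2) atTop (𝓝 0) := by
  obtain ⟨χ, hχ, h0, h1, hχK, -⟩ := exists_isTest_bump hK isOpen_univ (subset_univ _)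
  exact H.tendsto_lintegral_sq hχ (fun z => by rw [Real.norm_of_nonneg (h0 z)]; exact h1 z) hK hχK

/-- The key estimate for the defect measures, tested with a power of a cut-off function. -/
theorem exists_defect_le : ∃ C : ℝ≥0, ∀ (T : ℝ) (u : ℕ → SpaceTime → R4)
    (Du : ℕ → Fin 4 → SpaceTime → R4) (v : SpaceTime → R4) (Dv : Fin 4 → SpaceTime → R4)
    (N E : ℝ≥0) (μ ν : Measure SpaceTime),
    IsVanishing T (fun k => u k - v) (fun k => Du k - Dv) N E →
    (∀ k, IsEnergyClass T (u k) (Du k)) → IsEnergyClass T v Dv →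
    TendstoWeakly (fun k => gradMeasure T (Du k)) μ →
    TendstoWeakly (fun k => cubeMeasure T (u k)) ν →
    ∀ O : Set SpaceTime, IsOpen O → ∀ a : ℝ≥0,
    (∃ᶠ k in atTop, normLinfL2 (O ∩ slab T) (u k - v) < a) →
    ∀ φ : SpaceTime → ℝ, IsTest φ → (∀ z, 0 ≤ φ z) → (∀ z, φ z ≤ 1) → (∀ z, z ∉ O → φ z = 0) →
    ∫ z, φ z ^ 3 ∂ν - ∫ z in slab T, φ z ^ 3 * ‖v z‖ ^ 3
      ≤ C * a * (∫ z, φ z ^ 2 ∂μ - ∫ z in slab T, φ z ^ 2 * gradSq Dv z) := by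
  obtain ⟨C, hC⟩ := exists_lintegral_cube_le
  -- `8 = 4 · 2`: `4` from the Brezis–Lieb bound, `2` from splitting `∇(φ w)`.
  refine ⟨8 * C, fun T u Du v Dv N E μ ν H hu hv hμ hν O hO a ha φ hφ h0 h1 hs => ?_⟩
  obtain ⟨c, -, hc⟩ := hφ.exists_bound
  obtain ⟨ms, hms, hlt⟩ := extraction_of_frequently_atTop ha
  have hφ2 : IsTest fun z => φ z ^ 2 := hφ.pow two_ne_zero
  have hφ3 : IsTest fun z => φ z ^ 3 := hφ.pow three_ne_zero
  have hn1 : ∀ z, ‖φ z‖ ≤ 1 := fun z => by rw [Real.norm_of_nonneg (h0 z)]; exact h1 z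
  have hg0 : ∀ k z, 0 ≤ φ z ^ 2 * gradSq (Du k - Dv) z := fun k z =>
    mul_nonneg (by positivity) (Finset.sum_nonneg fun _ _ => by positivity)
  set A : ℕ → ℝ := fun k => ∫ z in slab T, φ z ^ 2 * gradSq (Du k - Dv) z with hA
  set L : ℕ → ℝ := fun k => (∫⁻ z in tsupport φ ∩ slab T, ‖(u k - v) z‖ₑ ^ 2).toReal with hL
  have hAe : ∀ k, ∫⁻ z in slab T, ‖φ z‖ₑ ^ 2 * ∑ j, ‖(Du k - Dv) j z‖ₑ ^ 2
      = ENNReal.ofReal (A k) := fun k => by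
    rw [hA, ofReal_integral_eq_lintegral_ofReal
      (hφ2.integrable_mul (integrable_gradSq (H.memLp_grad k))) (Eventually.of_forall (hg0 k))]
    refine lintegral_congr fun z => ?_
    rw [ENNReal.ofReal_mul (by positivity), gradSq,
      ENNReal.ofReal_sum_of_nonneg fun _ _ => by positivity]
    simp [ENNReal.ofReal_pow, ofReal_norm, Real.enorm_of_nonneg (h0 z), h0 z]
  have hLe : ∀ k, ∫⁻ z in tsupport φ ∩ slab T, ‖(u k - v) z‖ₑ ^ 2 = ENNReal.ofReal (L k) :=
    fun k => (ENNReal.ofReal_toReal (((lintegral_mono_set inter_subset_right).trans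
      (H.lintegral_sq_le k)).trans_lt ENNReal.coe_lt_top).ne).symm
  have hlimL : Tendsto L atTop (𝓝 0) := by
    have := (ENNReal.tendsto_toReal ENNReal.zero_ne_top).comp
      (H.tendsto_lintegral_sq_compact hφ.hasCompactSupport.isCompact)
    rwa [ENNReal.toReal_zero] at this
  have hlimA := tendsto_integral_gradSq_sub H hu hv hμ hφ2
  -- The term carrying the derivative of `φ` tends to zero, so the limit involves the gradient
  -- defect alone.
  have hlim := (((hlimA.const_mul 2).add (hlimL.const_mul (8 * (c : ℝ) ^ 2))).const_mul
    (C * a : ℝ)).comp hms.tendsto_atTop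
  have hfin := integral_le_of_subseq_cube_le H hu hv hν hφ3 (fun z => by have := h0 z; positivity)
    hms.tendsto_atTop (fun k => ?_) hlim
  · push_cast
    linarith
  simp only [Function.comp_apply]
  have hL0 : 0 ≤ L (ms k) := ENNReal.toReal_nonneg
  have hA0 : 0 ≤ A (ms k) := integral_nonneg (hg0 _)
  have hint : ∫ z in slab T, φ z ^ 3 * ‖(u (ms k) - v) z‖ ^ 3
      = (∫⁻ z in slab T, ‖φ z • (u (ms k) - v) z‖ₑ ^ 3).toReal := by
    rw [integral_eq_lintegral_of_nonneg_ae (Eventually.of_forall fun z => by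
      have := h0 z; simp only [Pi.zero_apply]; positivity)
      ((H.hasWeakGrad _).integrable_test_mul_cube (H.normLinfL2_le _) (H.energy_le _) hφ3).1]
    congr 1
    refine lintegral_congr fun z => ?_
    rw [← ofReal_norm, ← ENNReal.ofReal_pow (norm_nonneg _), norm_smul, mul_pow,
      Real.norm_of_nonneg (h0 z)]
  rw [hint]
  refine ENNReal.toReal_le_of_le_ofReal (by positivity) ?_
  refine (hC T _ _ (H.hasWeakGrad (ms k)) φ hφ hn1 O hO hs).trans ?_
  rw [ENNReal.ofReal_mul (by positivity), ENNReal.ofReal_mul (by positivity),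
    ENNReal.ofReal_coe_nnreal, ENNReal.ofReal_coe_nnreal]
  gcongr
  · exact (hlt k).le
  · refine (lintegral_mono fun z => sum_enorm_cutoff_sq_le hc _ _ z).trans (le_of_eq ?_)
    rw [lintegral_add_right', lintegral_const_mul' _ _ (by simp),
      lintegral_const_mul' _ _ (by finiteness), hAe,
      lintegral_indicator (isClosed_tsupport φ).measurableSet,
      Measure.restrict_restrict (isClosed_tsupport φ).measurableSet, hLe,
      ENNReal.ofReal_add (by positivity) (by positivity), ENNReal.ofReal_mul (by positivity),
      ENNReal.ofReal_mul (by positivity), ENNReal.ofReal_mul (by positivity),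
      ENNReal.ofReal_pow (by positivity), ENNReal.ofReal_coe_nnreal]
    · simp [hA]
    · exact (((H.hasWeakGrad _).aesm.enorm.pow_const 2).indicator
        (isClosed_tsupport φ).measurableSet).const_mul _

/-! ### Parabolic cylinders -/

theorem isOpen_cyl (r : ℝ) (z : SpaceTime) : IsOpen (cyl r z) := Metric.isOpen_ball.prod isOpen_Ioo

theorem mem_cyl {r : ℝ} (hr : 0 < r) (z : SpaceTime) : z ∈ cyl r z :=
  ⟨Metric.mem_ball_self hr, by constructor <;> have := pow_pos hr 2 <;> linarith⟩

theorem cyl_subset {r s : ℝ} (hr : 0 ≤ r) (hrs : r ≤ s) (z : SpaceTime) : cyl r z ⊆ cyl s z := by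
  have : r ^ 2 ≤ s ^ 2 := pow_le_pow_left₀ hr hrs 2
  exact prod_mono (Metric.ball_subset_ball hrs)
    (Ioo_subset_Ioo (by linarith) (by linarith))

end ParabolicCC

/-! ### Decomposition, estimate on open sets and density bound -/

open ParabolicCC in
theorem lemma2p5 :
    ∃ C : ℝ≥0, ∀ T : ℝ, 0 < T →
      ∀ (u : ℕ → ParabolicCC.SpaceTime → ParabolicCC.R4)
        (Du : ℕ → Fin 4 → ParabolicCC.SpaceTime → ParabolicCC.R4)
        (v : ParabolicCC.SpaceTime → ParabolicCC.R4)
        (Dv : Fin 4 → ParabolicCC.SpaceTime → ParabolicCC.R4)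
        (μ ν : Measure ParabolicCC.SpaceTime) [IsFiniteMeasure μ] [IsFiniteMeasure ν],
      -- `u k` is a bounded sequence in the energy space, and `v` is its limit
      (∀ k, ParabolicCC.IsEnergyClass T (u k) (Du k)) →
      (∃ M : ℝ≥0, ∀ k, ParabolicCC.normLinfL2 (ParabolicCC.slab T) (u k) ≤ M ∧
        ParabolicCC.normL2H1 T (u k) (Du k) ≤ M) →
      ParabolicCC.IsEnergyClass T v Dv →
      ParabolicCC.TendstoL1loc T u v →
      -- `μ` and `ν` are the weak limits of `|∇u k|² dx dt` and `|u k|³ dx dt` on the slab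
      μ (ParabolicCC.slab T)ᶜ = 0 →
      ν (ParabolicCC.slab T)ᶜ = 0 →
      ParabolicCC.TendstoWeakly (fun k => ParabolicCC.gradMeasure T (Du k)) μ →
      ParabolicCC.TendstoWeakly (fun k => ParabolicCC.cubeMeasure T (u k)) ν →
      Integrable (fun z => ‖v z‖ ^ 3) (volume.restrict (ParabolicCC.slab T)) ∧
      ∃ lam om : Measure ParabolicCC.SpaceTime, IsFiniteMeasure lam ∧ IsFiniteMeasure om ∧
        lam (ParabolicCC.slab T)ᶜ = 0 ∧ om (ParabolicCC.slab T)ᶜ = 0 ∧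
        (∀ φ : ParabolicCC.SpaceTime → ℝ,
          ContDiff ℝ ((⊤ : ℕ∞) : WithTop ℕ∞) φ → HasCompactSupport φ →
            ∫ z, φ z ∂μ =
                (∫ z in ParabolicCC.slab T, φ z * ParabolicCC.gradSq Dv z) + ∫ z, φ z ∂lam ∧
            ∫ z, φ z ∂ν =
                (∫ z in ParabolicCC.slab T, φ z * ‖v z‖ ^ 3) + ∫ z, φ z ∂om) ∧
        om ≪ lam ∧
        -- the estimate on every relatively open subset `Q = O ∩ D` of the slab `D`
        (∀ O : Set ParabolicCC.SpaceTime, IsOpen O →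
          om (O ∩ ParabolicCC.slab T) ≤
            C * liminf (fun k => ParabolicCC.normLinfL2 (O ∩ ParabolicCC.slab T) (u k - v)) atTop *
              lam (O ∩ ParabolicCC.slab T)) ∧
        -- the bound on the density, the limit as `r → 0⁺` being part of the claim
        (∀ᵐ z ∂lam, ∃ l : ℝ≥0∞,
          Tendsto (fun r : ℝ => liminf (fun k =>
              ParabolicCC.normLinfL2 (ParabolicCC.cyl r z ∩ ParabolicCC.slab T) (u k - v)) atTop)
            (𝓝[>] 0) (𝓝 l) ∧
          om.rnDeriv lam z ≤ C * l) := by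
  obtain ⟨C, hC⟩ := exists_defect_le
  refine ⟨C, fun T _ u Du v Dv μ ν _ _ hu hM hv hL hμ0 hν0 hμ hν => ?_⟩
  obtain ⟨M, hM⟩ := hM
  obtain ⟨N, E, H⟩ := exists_isVanishing_sub hu hM hv hL
  have hgv : IsFiniteMeasure (gradMeasure T Dv) := isFiniteMeasure_gradMeasure hv.memLp_grad
  have hgrad : gradMeasure T Dv ≤ μ := by
    rw [← one_smul ℝ≥0∞ μ]
    refine measure_le_smul_of_isOpen ENNReal.one_ne_top fun O hO => ?_
    refine measure_isOpen_le_of_test hO 1 one_ne_zero fun φ hφ h0 _ _ => ?_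
    simp only [pow_one, one_mul]
    rw [← hφ.ofReal_integral h0, ← hφ.ofReal_integral h0, integral_gradMeasure hv.aesm_grad]
    refine ENNReal.ofReal_le_ofReal (sub_nonneg.1 ?_)
    exact ge_of_tendsto' (tendsto_integral_gradSq_sub H hu hv hμ hφ) fun k =>
      integral_nonneg fun z => mul_nonneg (h0 z) (Finset.sum_nonneg fun _ _ => by positivity)
  -- Comparison on open sets requires the smaller measure to be finite, so finiteness of `|v|³ dx
  -- dt` is obtained first, by exhausting with balls.
  have hcube_compact : ∀ n : ℕ, cubeMeasure T v (Metric.closedBall 0 n) ≤ ν univ := fun n => by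
    obtain ⟨φ, hφ, h0, h1, hK, hs⟩ := exists_isTest_bump
      (isCompact_closedBall (0 : SpaceTime) (n : ℝ)) isOpen_univ (subset_univ _)
    have h2 := measure_le_lintegral_test (m := cubeMeasure T v)
      (isCompact_closedBall (0 : SpaceTime) (n : ℝ)) hK 1
    have h3 := lintegral_test_le_measure (m := ν) isOpen_univ h0 h1 hs one_ne_zero
    simp only [pow_one] at h2 h3
    exact h2.trans ((lintegral_cubeMeasure_le H hu hv hν hφ h0).trans h3)
  have hcube_univ : cubeMeasure T v univ ≤ ν univ := by
    rw [← Metric.iUnion_closedBall_nat (0 : SpaceTime)]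
    refine (le_of_tendsto' (tendsto_measure_iUnion_atTop fun m n hmn =>
      Metric.closedBall_subset_closedBall (by exact_mod_cast hmn)) hcube_compact).trans ?_
    rw [Metric.iUnion_closedBall_nat]
  have hcv : IsFiniteMeasure (cubeMeasure T v) := ⟨hcube_univ.trans_lt (measure_lt_top ν _)⟩
  have hcube : cubeMeasure T v ≤ ν := by
    rw [← one_smul ℝ≥0∞ ν]
    refine measure_le_smul_of_isOpen ENNReal.one_ne_top fun O hO => ?_
    refine measure_isOpen_le_of_test hO 1 one_ne_zero fun φ hφ h0 _ _ => ?_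
    simp only [pow_one, one_mul]
    exact lintegral_cubeMeasure_le H hu hv hν hφ h0
  have hint3 : Integrable (fun z => ‖v z‖ ^ 3) (volume.restrict (slab T)) := by
    refine ⟨hv.aesm.norm.pow 3, ?_⟩
    have : cubeMeasure T v univ < ∞ := measure_lt_top _ _
    rw [cubeMeasure, withDensity_apply _ MeasurableSet.univ, Measure.restrict_univ] at this
    refine lt_of_le_of_lt (lintegral_mono fun z => le_of_eq ?_) this
    rw [Real.enorm_of_nonneg (by positivity)]
  -- Subtraction of measures is truncated in general; `hgrad` and `hcube` make it exact here.
  set lam := μ - gradMeasure T Dv with hlam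
  set om := ν - cubeMeasure T v with hom
  have hlam_add : lam + gradMeasure T Dv = μ := Measure.sub_add_cancel_of_le hgrad
  have hom_add : om + cubeMeasure T v = ν := Measure.sub_add_cancel_of_le hcube
  have hlam_fin : IsFiniteMeasure lam := inferInstance
  have hom_fin : IsFiniteMeasure om := inferInstance
  have hlam0 : lam (slab T)ᶜ = 0 := le_antisymm ((Measure.sub_le _).trans hμ0.le) zero_le
  have hom0 : om (slab T)ᶜ = 0 := le_antisymm ((Measure.sub_le _).trans hν0.le) zero_le
  have hdec : ∀ φ : SpaceTime → ℝ, IsTest φ →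
      ∫ z, φ z ∂μ = (∫ z in slab T, φ z * gradSq Dv z) + ∫ z, φ z ∂lam ∧
      ∫ z, φ z ∂ν = (∫ z in slab T, φ z * ‖v z‖ ^ 3) + ∫ z, φ z ∂om := fun φ hφ => by
    have hi : ∀ (m : Measure SpaceTime) [IsFiniteMeasure m], Integrable φ m := fun m _ =>
      hφ.continuous.integrable_of_hasCompactSupport hφ.hasCompactSupport
    rw [← integral_gradMeasure hv.aesm_grad, ← integral_cubeMeasure hv.aesm, add_comm,
      ← integral_add_measure (hi _) (hi _), hlam_add, add_comm,
      ← integral_add_measure (hi _) (hi _), hom_add]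
    exact ⟨rfl, rfl⟩
  have hinter : ∀ {m : Measure SpaceTime}, m (slab T)ᶜ = 0 → ∀ O, m (O ∩ slab T) = m O :=
    fun hm O => measure_inter_conull hm
  have hlim_ne : ∀ O, liminf (fun k => normLinfL2 (O ∩ slab T) (u k - v)) atTop ≤ N := fun O =>
    liminf_le_of_frequently_le' (Frequently.of_forall fun k =>
      (normLinfL2_mono inter_subset_right _).trans (H.normLinfL2_le k))
  have hfreq : ∀ O, IsOpen O → ∀ a : ℝ≥0,
      liminf (fun k => normLinfL2 (O ∩ slab T) (u k - v)) atTop < a → om O ≤ C * a * lam O := by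
    intro O hO a ha
    refine measure_isOpen_le_of_test hO 3 two_ne_zero fun φ hφ h0 h1 hs => ?_
    have h := hC T u Du v Dv N E μ ν H hu hv hμ hν O hO a (frequently_lt_of_liminf_lt (h := ha))
      φ hφ h0 h1 hs
    have hφ2 : IsTest fun z => φ z ^ 2 := hφ.pow two_ne_zero
    have hφ3 : IsTest fun z => φ z ^ 3 := hφ.pow three_ne_zero
    rw [(hdec _ hφ2).1, (hdec _ hφ3).2, add_sub_cancel_left, add_sub_cancel_left] at h
    rw [← hφ2.ofReal_integral fun z => by positivity,
      ← hφ3.ofReal_integral fun z => by have := h0 z; positivity]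
    refine (ENNReal.ofReal_le_ofReal h).trans (le_of_eq ?_)
    rw [ENNReal.ofReal_mul (by positivity), ENNReal.ofReal_mul (by positivity),
      ENNReal.ofReal_coe_nnreal, ENNReal.ofReal_coe_nnreal]
  have hopen : ∀ O, IsOpen O →
      om O ≤ C * liminf (fun k => normLinfL2 (O ∩ slab T) (u k - v)) atTop * lam O := by
    intro O hO
    obtain ⟨A, hA⟩ : ∃ A : ℝ≥0, (A : ℝ≥0∞)
        = liminf (fun k => normLinfL2 (O ∩ slab T) (u k - v)) atTop :=
      ⟨_, ENNReal.coe_toNNReal ((hlim_ne O).trans_lt ENNReal.coe_lt_top).ne⟩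
    rw [← hA]
    -- A strict bound `liminf < a` is what provides a subsequence with norms below `a`; letting `a`
    -- decrease to the lower limit recovers the sharp form.
    have ht : Tendsto (fun a : ℝ≥0 => (C : ℝ≥0∞) * a * lam O) (𝓝[>] A) (𝓝 (C * A * lam O)) := by
      refine ENNReal.Tendsto.mul_const (ENNReal.Tendsto.const_mul ?_ (Or.inr ENNReal.coe_ne_top))
        (Or.inr (measure_ne_top _ _))
      exact (ENNReal.continuous_coe.tendsto A).mono_left nhdsWithin_le_nhds
    refine ge_of_tendsto ht ?_
    filter_upwards [self_mem_nhdsWithin] with a ha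
    exact hfreq O hO a (by rw [← hA]; exact_mod_cast ha)
  have hac : om ≪ lam := by
    have h1 : om ≤ (C * N : ℝ≥0∞) • lam := by
      refine measure_le_smul_of_isOpen (by finiteness) fun O hO => (hopen O hO).trans ?_
      gcongr
      exact hlim_ne O
    exact (Measure.absolutelyContinuous_of_le h1).trans (Measure.smul_absolutelyContinuous)
  refine ⟨hint3, lam, om, hlam_fin, hom_fin, hlam0, hom0, fun φ h1 h2 => hdec φ ⟨h1, h2⟩, hac,
    fun O hO => ?_, ?_⟩
  · rw [hinter hlam0, hinter hom0]
    exact hopen O hO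
  have hmono : ∀ {U O : Set SpaceTime}, U ⊆ O →
      liminf (fun k => normLinfL2 (U ∩ slab T) (u k - v)) atTop
        ≤ liminf (fun k => normLinfL2 (O ∩ slab T) (u k - v)) atTop := fun hUO =>
    liminf_le_liminf (Eventually.of_forall fun k =>
      normLinfL2_mono (inter_subset_inter_left _ hUO) _)
  -- Countability of the basis gives one null set outside which all the bounds hold.
  have hbasis : ∀ᵐ z ∂lam, ∀ O ∈ TopologicalSpace.countableBasis SpaceTime, z ∈ O →
      om.rnDeriv lam z ≤ C * liminf (fun k => normLinfL2 (O ∩ slab T) (u k - v)) atTop := by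
    refine (ae_ball_iff (TopologicalSpace.countable_countableBasis SpaceTime)).2 fun O hO => ?_
    refine ae_rnDeriv_le_of_isOpen hac ?_ (TopologicalSpace.isOpen_of_mem_countableBasis hO)
      fun U hU hUO => (hopen U hU).trans ?_
    · exact ENNReal.mul_ne_top ENNReal.coe_ne_top ((hlim_ne O).trans_lt ENNReal.coe_lt_top).ne
    · gcongr
      exact hmono hUO
  filter_upwards [hbasis] with z hz
  -- The lower limit is monotone in the radius, so its limit at `0⁺` exists.
  have htend := MonotoneOn.tendsto_nhdsGT (x := (0 : ℝ)) (f := fun r : ℝ =>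
      liminf (fun k => normLinfL2 (cyl r z ∩ slab T) (u k - v)) atTop)
    (fun r hr s _ hrs => hmono (cyl_subset (le_of_lt hr) hrs z)) (OrderBot.bddBelow _)
  refine ⟨_, htend, ge_of_tendsto (ENNReal.Tendsto.const_mul htend (Or.inr ENNReal.coe_ne_top)) ?_⟩
  filter_upwards [self_mem_nhdsWithin] with r hr
  obtain ⟨O, hO, hzO, hOr⟩ :=
    (TopologicalSpace.isBasis_countableBasis SpaceTime).exists_subset_of_mem_open
      (mem_cyl hr z) (isOpen_cyl r z)
  refine (hz O hO hzO).trans ?_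
  gcongr
  exact hmono hOr
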